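/- Let $p$ be a prime and let $A\in \mathrm{GL}_2(\mathbb Z[1/p])$ be conjugate in $\mathrm{GL}_2(\mathbb Z[1/p])$ to $\mathrm{diag}(p,1/p)$. Let $G_p=\mathbb Z[1/p]^2\rtimes_A\mathbb Z$, where $n\in\mathbb Z$ acts on $\mathbb Z[1/p]^2$ by $A^n$. Let $\mathbb H^2_p=\mathbb R\rtimes_{p^t}\mathbb R$ with the left-invariant Riemannian metric $p^{-2t}dx^2+dt^2$ and the Busemann function $\beta(x,t)=-t$. Let $T_p$ be the $(p+1)$-regular tree with edges of length one and with a Busemann function $\beta_T$ that is integral at the vertices. Let $\mathbb H^2_p[p]=\{(z,v)\in \mathbb H^2_p\times T_p : \beta(z)=\beta_T(v)\}$ be the mixed millefeuille space, with the length metric in which a path has the length of its projection to $\mathbb H^2_p$, and with the Busemann function $\beta(z,v)=\beta(z)$. For $X=Y=\mathbb H^2_p[p]$ let $X\bowtie Y=\{(x,y)\in X\times Y : \beta_X(x)=-\beta_Y(y)\}$ be the horocyclic product. A norm $N$ on $\mathbb R^2$ is admissible and monotone if $N(1,1)=1$, $N(a,b)\ge (a+b)/2$, and $N$ is non-decreasing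 in each variable on $[0,\infty)^2$. For such $N$, let $d_N$ be the metric on $X\bowtie Y$ for which the distance of two points is the infimum of the $N$-lengths of the paths in $X\bowtie Y$ that join them, the $N$-length of a path being the supremum over all partitions of the sums $\sum_i N\big(d_X(x_i,x_{i+1}),d_Y(y_i,y_{i+1})\big)$. Then there is an action of $G_p$ on $X\bowtie Y$ such that 1. $G_p$ acts by product maps: every $g\in G_p$ acts as $(x,y)\mapsto (f_1(x),f_2(y))$, where $f_1,f_2$ are isometries of $X$ and $Y$ which fix the points at infinity at which $\beta_X$ and $\beta_Y$ are based, and for some $c\in\mathbb R$ one has $\beta_X(x)-\beta_X(f_1(x))=c$ and $\beta_Y(y)-\beta_Y(f_2(y))=-c$ for all $x\in X$, $y\in Y$; 2. for every admissible monotone norm $N$, the action is geometric for $d_N$: it is by isometries, it is proper (for every bounded $B$ the set $\{g : gB\cap B\neq\emptyset\}$ is finite), and it is cobounded (the translates of some bounded set cover $X\bowtie Y$). -/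

import Mathlib

open scoped ENNReal NNReal unitInterval Topology

namespace HorocyclicSol

/-! ### Geometric actions -/

/-- A set is bounded (of finite diameter) for the distance function `d`. -/
def BoundedFor {Z : Type*} (d : Z → Z → ℝ≥0∞) (B : Set Z) : Prop :=
  ∃ R : ℝ≥0, ∀ x ∈ B, ∀ y ∈ B, d x y ≤ R

/-- The action of `G` on `Z`, with distance function `d`, is geometric: it is by isometries, it is
proper (the coarse stabilizer `{g | g • B ∩ B ≠ ∅}` of every bounded set `B` is finite), and it is
cobounded (the translates of some bounded set cover `Z`). -/
structure IsGeometric (G : Type*) {Z : Type*} [Group G] [MulAction G Z]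
    (d : Z → Z → ℝ≥0∞) : Prop where
  isometric : ∀ (g : G) (x y : Z), d (g • x) (g • y) = d x y
  proper : ∀ B : Set Z, BoundedFor d B → {g : G | ∃ x ∈ B, g • x ∈ B}.Finite
  cobounded : ∃ B : Set Z, BoundedFor d B ∧ ∀ x : Z, ∃ g : G, ∃ b ∈ B, x = g • b

/-! ### Busemann functions, points at infinity -/

/-- `γ`, restricted to `[0, ∞)`, is a unit speed geodesic ray towards the point at infinity at which
`β` is based: `β` decreases along it at unit speed. -/
def IsVerticalRay {X : Type*} [PseudoEMetricSpace X] (β : X → ℝ) (γ : ℝ → X) : Prop :=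
  (∀ s t : ℝ, 0 ≤ s → 0 ≤ t → edist (γ s) (γ t) = ENNReal.ofReal |s - t|) ∧
    ∀ s : ℝ, 0 ≤ s → β (γ s) = β (γ 0) - s

/-- The isometry `f` fixes the point at infinity at which the Busemann function `β` is based: a ray
representing this point is sent to a ray at finite distance from it. -/
def FixesInfinity {X : Type*} [PseudoEMetricSpace X] (β : X → ℝ) (f : X ≃ᵢ X) : Prop :=
  ∃ γ : ℝ → X, IsVerticalRay β γ ∧ ∃ C : ℝ≥0, ∀ s : ℝ, 0 ≤ s → edist (γ s) (f (γ s)) ≤ C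

/-- The height change `h(f) = β(x) - β(f x)` of `f` is `c`, for every `x`. -/
def HasHeightChange {X : Type*} [PseudoEMetricSpace X] (β : X → ℝ) (f : X ≃ᵢ X) (c : ℝ) : Prop :=
  ∀ x, β x - β (f x) = c

/-! ### Horocyclic products -/

/-- The underlying set `{(x, y) | βX x = - βY y}` of the horocyclic product `X ⋈ Y`. -/
@[ext]
structure Horocyclic {X Y : Type*} (βX : X → ℝ) (βY : Y → ℝ) where
  fst : X
  snd : Y
  busemann_eq : βX fst = -βY snd

/-- An admissible, monotone norm on `ℝ²`. -/
structure IsAdmissibleMonotone (N : Seminorm ℝ (ℝ × ℝ)) : Prop where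
  eq_zero : ∀ v, N v = 0 → v = 0
  apply_one : N (1, 1) = 1
  le_apply : ∀ x y : ℝ, (x + y) / 2 ≤ N (x, y)
  mono : ∀ x x' y y' : ℝ, 0 ≤ x → x ≤ x' → 0 ≤ y → y ≤ y' → N (x, y) ≤ N (x', y')

/-- The `N`-length of a path `t ↦ (γ t, δ t)`: the supremum of
`∑ N (d_X (γ tᵢ) (γ tᵢ₊₁), d_Y (δ tᵢ) (δ tᵢ₊₁))` over all partitions of `[0, 1]`. -/
noncomputable def pathLength {X Y : Type*} [PseudoEMetricSpace X] [PseudoEMetricSpace Y]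
    (N : Seminorm ℝ (ℝ × ℝ)) (γ : I → X) (δ : I → Y) : ℝ≥0∞ :=
  ⨆ (n : ℕ) (u : ℕ → I) (_ : Monotone u ∧ u 0 = 0 ∧ u n = 1),
    ∑ i ∈ Finset.range n, ENNReal.ofReal
      (N ((edist (γ (u i)) (γ (u (i + 1)))).toReal, (edist (δ (u i)) (δ (u (i + 1)))).toReal))

/-- The distance on the horocyclic product defined by the norm `N`: the infimum of the `N`-lengths
of the continuous paths in `X ⋈ Y` joining two points. -/
noncomputable def horoEDist {X Y : Type*} [PseudoEMetricSpace X] [PseudoEMetricSpace Y]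
    {βX : X → ℝ} {βY : Y → ℝ} (N : Seminorm ℝ (ℝ × ℝ)) (a b : Horocyclic βX βY) : ℝ≥0∞ :=
  ⨅ (γ : Path a.fst b.fst) (δ : Path a.snd b.snd) (_ : ∀ t, βX (γ t) = -βY (δ t)),
    pathLength N γ δ

/-- `(x, y) ↦ (f x, g y)` is a product map: `f` and `g` are isometries of `X` and `Y` which fix the
points at infinity, with opposite height changes. -/
def IsProductMap {X Y : Type*} [PseudoEMetricSpace X] [PseudoEMetricSpace Y]
    (βX : X → ℝ) (βY : Y → ℝ) (f : X ≃ᵢ X) (g : Y ≃ᵢ Y) : Prop :=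
  FixesInfinity βX f ∧ FixesInfinity βY g ∧
    ∃ c : ℝ, HasHeightChange βX f c ∧ HasHeightChange βY g (-c)

/-- `G` acts on `X ⋈ Y` by product maps. -/
def ActsByProductMaps (G : Type*) [Group G] {X Y : Type*} [PseudoEMetricSpace X]
    [PseudoEMetricSpace Y] (βX : X → ℝ) (βY : Y → ℝ) [MulAction G (Horocyclic βX βY)] : Prop :=
  ∀ g : G, ∃ (f₁ : X ≃ᵢ X) (f₂ : Y ≃ᵢ Y), IsProductMap βX βY f₁ f₂ ∧
    ∀ z : Horocyclic βX βY, (g • z).fst = f₁ z.fst ∧ (g • z).snd = f₂ z.snd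

/-! ### Millefeuille spaces -/

/-- The millefeuille space `{(x, v) ∈ X × T | βX x = βT v}` (here `T` is going to be a tree). -/
@[ext]
structure Millefeuille {X T : Type*} (βX : X → ℝ) (βT : T → ℝ) where
  fst : X
  snd : T
  busemann_eq : βX fst = βT snd

namespace Millefeuille

variable {X T : Type*} {βX : X → ℝ} {βT : T → ℝ}

/-- The Busemann function of a millefeuille space. -/
def busemann (a : Millefeuille βX βT) : ℝ := βX a.fst

variable [PseudoEMetricSpace X] [TopologicalSpace T]

/-- The length metric of the millefeuille space. The millefeuille space is a union of copies
of `X`, one over each vertical line of `T`; so the length of a path is the length of its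
projection to `X`, and the distance is the infimum of the lengths of the continuous paths in
`{(x, v) | βX x = βT v}` that join two points. -/
noncomputable def pathEDist (a b : Millefeuille βX βT) : ℝ≥0∞ :=
  ⨅ (γ : Path a.fst b.fst) (δ : Path a.snd b.snd) (_ : ∀ t, βX (γ t) = βT (δ t)),
    eVariationOn γ Set.univ

theorem eVariationOn_trans_le {x y z : X} (γ : Path x y) (γ' : Path y z) :
    eVariationOn (γ.trans γ') Set.univ ≤ eVariationOn γ Set.univ + eVariationOn γ' Set.univ := by
  have h2 : (1 / 2 : ℝ) ∈ I := by constructor <;> norm_num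
  have hu : (Set.univ : Set I) = Set.Iic ⟨1 / 2, h2⟩ ∪ Set.Ici ⟨1 / 2, h2⟩ := Set.Iic_union_Ici.symm
  have hv := eVariationOn.union (γ.trans γ') (s := Set.Iic ⟨1 / 2, h2⟩) (t := Set.Ici ⟨1 / 2, h2⟩)
    (x := ⟨1 / 2, h2⟩) isGreatest_Iic isLeast_Ici
  refine ((congrArg _ hu).trans hv).trans_le ?_
  refine add_le_add ?_ ?_
  · rw [eVariationOn.eq_of_eqOn (f' := γ ∘ fun t : I => Set.projIcc 0 1 zero_le_one (2 * (t : ℝ)))]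
    · refine eVariationOn.comp_le_of_monotoneOn _ _ ?_ (fun _ _ => Set.mem_univ _) |>.trans
        (eVariationOn.mono _ (by simp))
      intro a _ b _ hab
      exact Set.monotone_projIcc _ (by have : (a : ℝ) ≤ b := hab; linarith)
    · intro t ht
      have ht' : (t : ℝ) ≤ 1 / 2 := ht
      simp only [Path.trans_apply, ht', dite_true, Function.comp]
      congr 1
      exact (Set.projIcc_of_mem zero_le_one _).symm
  · rw [eVariationOn.eq_of_eqOn
      (f' := γ' ∘ fun t : I => Set.projIcc 0 1 zero_le_one (2 * (t : ℝ) - 1))]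
    · refine eVariationOn.comp_le_of_monotoneOn _ _ ?_ (fun _ _ => Set.mem_univ _) |>.trans
        (eVariationOn.mono _ (by simp))
      intro a _ b _ hab
      exact Set.monotone_projIcc _ (by have : (a : ℝ) ≤ b := hab; linarith)
    · intro t ht
      have ht' : 1 / 2 ≤ (t : ℝ) := ht
      rcases ht'.eq_or_lt with h | h
      · have : t = ⟨1 / 2, h2⟩ := Subtype.ext h.symm
        subst this
        have e : Set.projIcc (0 : ℝ) 1 zero_le_one (2 * (1 / 2) - 1) = 0 := by norm_num
        simp only [Function.comp, e, Path.source]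
        norm_num [Path.trans_apply]
      · simp only [Path.trans_apply, not_le.2 h, dite_false, Function.comp]
        congr 1
        exact (Set.projIcc_of_mem zero_le_one _).symm

noncomputable instance : PseudoEMetricSpace (Millefeuille βX βT) where
  edist := pathEDist
  edist_self a := by
    refine le_antisymm ?_ bot_le
    unfold pathEDist
    refine (iInf₂_le (Path.refl a.fst) (Path.refl a.snd)).trans
      ((iInf_le _ (fun _ => a.busemann_eq)).trans (le_of_eq ?_))
    exact eVariationOn.constant_on (by simp [Set.Subsingleton])
  edist_comm a b := by
    have key : ∀ a b : Millefeuille βX βT, pathEDist a b ≤ pathEDist b a := fun a b => by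
      refine le_iInf₂ fun γ δ => le_iInf fun h => ?_
      refine (iInf₂_le γ.symm δ.symm).trans ((iInf_le _ (fun t => h _)).trans ?_)
      exact eVariationOn.comp_le_of_antitoneOn _ _
        (fun a _ b _ hab => unitInterval.symm_le_symm.2 hab) (fun _ _ => Set.mem_univ _)
    exact le_antisymm (key a b) (key b a)
  edist_triangle a b c := by
    simp only [pathEDist, ENNReal.iInf_add, ENNReal.add_iInf]
    refine le_iInf₂ fun γ' δ' => le_iInf fun h' => le_iInf₂ fun γ δ => le_iInf fun h => ?_
    refine (iInf₂_le (γ.trans γ') (δ.trans δ')).trans ((iInf_le _ (fun t => ?_)).trans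
      (eVariationOn_trans_le γ γ'))
    simp only [Path.trans_apply]
    split_ifs
    exacts [h _, h' _]

end Millefeuille

/-! ### The Heintze group `ℍ²_p = ℝ ⋊ ℝ` -/

/-- The Heintze group `ℍ²_p = ℝ ⋊ ℝ`, where `t` acts on the first factor as multiplication
by `p ^ t`. -/
@[ext]
structure HeintzePlane (p : ℕ) where
  x : ℝ
  t : ℝ

namespace HeintzePlane

variable {p : ℕ}

noncomputable instance [hp : Fact p.Prime] : Group (HeintzePlane p) where
  mul a b := ⟨a.x + (p : ℝ) ^ a.t * b.x, a.t + b.t⟩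
  one := ⟨0, 0⟩
  inv a := ⟨-((p : ℝ) ^ (-a.t) * a.x), -a.t⟩
  mul_assoc a b c := by
    have h : (0 : ℝ) < p := by exact_mod_cast hp.out.pos
    change (⟨(a.x + (p : ℝ) ^ a.t * b.x) + (p : ℝ) ^ (a.t + b.t) * c.x, (a.t + b.t) + c.t⟩ :
      HeintzePlane p) = ⟨a.x + (p : ℝ) ^ a.t * (b.x + (p : ℝ) ^ b.t * c.x), a.t + (b.t + c.t)⟩
    rw [Real.rpow_add h]
    ext
    · ring
    · ring
  one_mul a := by
    change (⟨0 + (p : ℝ) ^ (0 : ℝ) * a.x, 0 + a.t⟩ : HeintzePlane p) = a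
    simp
  mul_one a := by
    change (⟨a.x + (p : ℝ) ^ a.t * 0, a.t + 0⟩ : HeintzePlane p) = a
    simp
  inv_mul_cancel a := by
    change (⟨-((p : ℝ) ^ (-a.t) * a.x) + (p : ℝ) ^ (-a.t) * a.x, -a.t + a.t⟩ : HeintzePlane p)
      = ⟨0, 0⟩
    simp

theorem mul_def [Fact p.Prime] (a b : HeintzePlane p) :
    a * b = ⟨a.x + (p : ℝ) ^ a.t * b.x, a.t + b.t⟩ := rfl

/-- The coordinates `(x, t) ↦ log p * x + i * p ^ t` of `ℍ²_p` in the upper half plane. -/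
noncomputable def toUpperHalfPlane [hp : Fact p.Prime] (a : HeintzePlane p) : UpperHalfPlane :=
  ⟨⟨Real.log p * a.x, (p : ℝ) ^ a.t⟩,
    Real.rpow_pos_of_pos (by exact_mod_cast hp.out.pos) a.t⟩

theorem log_pos [hp : Fact p.Prime] : 0 < Real.log p :=
  Real.log_pos (by exact_mod_cast hp.out.one_lt)

/-- The distance of the left-invariant Riemannian metric on `ℍ²_p` which is Euclidean at the origin,
that is of `ds² = p ^ (-2 * t) dx² + dt²`. Under `(x, t) ↦ (X, Y) = (log p * x, p ^ t)` the metric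
`(dX² + dY²) / Y²` of the hyperbolic plane becomes `(log p)² ds²`, so this is the hyperbolic
distance divided by `log p`. -/
noncomputable instance [Fact p.Prime] : MetricSpace (HeintzePlane p) where
  dist a b := dist a.toUpperHalfPlane b.toUpperHalfPlane / Real.log p
  dist_self a := by simp
  dist_comm a b := by simp [dist_comm]
  dist_triangle a b c := by
    rw [← add_div]
    exact div_le_div_of_nonneg_right (dist_triangle _ _ _) log_pos.le
  eq_of_dist_eq_zero {a b} h := by
    change dist a.toUpperHalfPlane b.toUpperHalfPlane / Real.log p = 0 at h
    have hl := log_pos (p := p)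
    have hp : (1 : ℝ) < p := by
      have := (Fact.out : p.Prime).one_lt
      exact_mod_cast this
    rw [div_eq_zero_iff, or_iff_left hl.ne', dist_eq_zero] at h
    have h1 := congrArg UpperHalfPlane.re h
    have h2 := congrArg UpperHalfPlane.im h
    change Real.log p * a.x = Real.log p * b.x at h1
    change (p : ℝ) ^ a.t = (p : ℝ) ^ b.t at h2
    ext
    · exact mul_left_cancel₀ hl.ne' h1
    · exact (Real.rpow_right_inj (by linarith) hp.ne').1 h2

theorem dist_def [Fact p.Prime] (a b : HeintzePlane p) :
    dist a b = dist a.toUpperHalfPlane b.toUpperHalfPlane / Real.log p := rfl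

/-- The metric is left-invariant. -/
theorem dist_mul_left [hp : Fact p.Prime] (g a b : HeintzePlane p) :
    dist (g * a) (g * b) = dist a b := by
  have h : (0 : ℝ) < p := by exact_mod_cast hp.out.pos
  have key : ∀ a : HeintzePlane p, (g * a).toUpperHalfPlane = (Real.log p * g.x) +ᵥ
      ((⟨(p : ℝ) ^ g.t, Real.rpow_pos_of_pos h _⟩ : {x : ℝ // 0 < x}) • a.toUpperHalfPlane) := by
    intro a
    refine UpperHalfPlane.ext (Complex.ext ?_ ?_)
    · change _ = (_ +ᵥ _ : UpperHalfPlane).re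
      rw [UpperHalfPlane.vadd_re, UpperHalfPlane.pos_real_re]
      change Real.log p * (g.x + (p : ℝ) ^ g.t * a.x) =
        Real.log p * g.x + (p : ℝ) ^ g.t * (Real.log p * a.x)
      ring
    · change _ = (_ +ᵥ _ : UpperHalfPlane).im
      rw [UpperHalfPlane.vadd_im, UpperHalfPlane.pos_real_im]
      change (p : ℝ) ^ (g.t + a.t) = (p : ℝ) ^ g.t * (p : ℝ) ^ a.t
      exact Real.rpow_add h _ _
  rw [dist_def, dist_def, key, key, (UpperHalfPlane.isometry_real_vadd _).dist_eq,
    (UpperHalfPlane.isometry_pos_mul _).dist_eq]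

/-- The Busemann function `(x, t) ↦ -t`. -/
def busemann (a : HeintzePlane p) : ℝ := -a.t

end HeintzePlane
/-! ### The `(p + 1)`-regular tree -/

/-- A point `x` of `ℚ_p` and a height `t`, which stand for the closed ball of radius `p ^ t`
around `x`. -/
structure BallData (p : ℕ) [Fact p.Prime] where
  x : ℚ_[p]
  t : ℝ

namespace BallData

variable {p : ℕ} [hp : Fact p.Prime]

theorem one_lt : (1 : ℝ) < p := by exact_mod_cast hp.out.one_lt

theorem pos : (0 : ℝ) < p := zero_lt_one.trans one_lt

/-- The height at which the balls merge: the least `h ≥ a.t, b.t` such that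
`‖a.x - b.x‖ ≤ p ^ h`. -/
noncomputable def merge (a b : BallData p) : ℝ :=
  Real.logb p (max (max ((p : ℝ) ^ a.t) ((p : ℝ) ^ b.t)) ‖a.x - b.x‖)

theorem merge_le_iff {a b : BallData p} {h : ℝ} :
    a.merge b ≤ h ↔ a.t ≤ h ∧ b.t ≤ h ∧ ‖a.x - b.x‖ ≤ (p : ℝ) ^ h := by
  have h0 : 0 < max (max ((p : ℝ) ^ a.t) ((p : ℝ) ^ b.t)) ‖a.x - b.x‖ :=
    lt_max_of_lt_left (lt_max_of_lt_left (Real.rpow_pos_of_pos pos _))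
  rw [merge, Real.logb_le_iff_le_rpow one_lt h0, max_le_iff, max_le_iff,
    Real.rpow_le_rpow_left_iff one_lt, Real.rpow_le_rpow_left_iff one_lt, and_assoc]

theorem merge_spec (a b : BallData p) :
    a.t ≤ a.merge b ∧ b.t ≤ a.merge b ∧ ‖a.x - b.x‖ ≤ (p : ℝ) ^ a.merge b :=
  merge_le_iff.1 le_rfl

theorem merge_comm (a b : BallData p) : a.merge b = b.merge a := by
  rw [merge, merge, max_comm ((p : ℝ) ^ a.t), norm_sub_rev]

theorem merge_triangle (a b c : BallData p) : a.merge c + b.t ≤ a.merge b + b.merge c := by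
  obtain ⟨h1, h2, h3⟩ := merge_spec a b
  obtain ⟨h4, h5, h6⟩ := merge_spec b c
  have h : a.merge c ≤ max (a.merge b) (b.merge c) := by
    refine merge_le_iff.2 ⟨h1.trans (le_max_left _ _), h5.trans (le_max_right _ _), ?_⟩
    have := Padic.nonarchimedean (a.x - b.x) (b.x - c.x)
    rw [sub_add_sub_cancel] at this
    refine this.trans (max_le ?_ ?_)
    · exact h3.trans ((Real.rpow_le_rpow_left_iff one_lt).2 (le_max_left _ _))
    · exact h6.trans ((Real.rpow_le_rpow_left_iff one_lt).2 (le_max_right _ _))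
  rcases max_cases (a.merge b) (b.merge c) with ⟨e, _⟩ | ⟨e, _⟩ <;> linarith

/-- The distance between two balls: go up to the height at which they merge, and down again. -/
noncomputable instance : PseudoMetricSpace (BallData p) where
  dist a b := (a.merge b - a.t) + (a.merge b - b.t)
  dist_self a := by
    have h : a.merge a = a.t :=
      le_antisymm (merge_le_iff.2 ⟨le_rfl, le_rfl, by
        simpa using (Real.rpow_pos_of_pos pos _).le⟩) (merge_spec a a).1
    simp [h]
  dist_comm a b := by simp only [merge_comm a b]; ring
  dist_triangle a b c := by
    have := merge_triangle a b c
    linarith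

theorem dist_def (a b : BallData p) : dist a b = (a.merge b - a.t) + (a.merge b - b.t) := rfl

theorem dist_eq_zero_iff (a b : BallData p) :
    dist a b = 0 ↔ a.t = b.t ∧ ‖a.x - b.x‖ ≤ (p : ℝ) ^ a.t := by
  obtain ⟨h1, h2, h3⟩ := merge_spec a b
  rw [dist_def]
  constructor
  · intro h
    have e1 : a.merge b = a.t := by linarith
    have e2 : a.merge b = b.t := by linarith
    exact ⟨e1.symm.trans e2, e1 ▸ h3⟩
  · rintro ⟨h4, h5⟩
    have : a.merge b ≤ a.t := merge_le_iff.2 ⟨le_rfl, h4.ge, h5⟩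
    linarith

end BallData

/-- The `(p + 1)`-regular tree `T_p`, as a metric space (all edges have length one), with
a distinguished point at infinity. It is the tree of balls of `ℚ_p`: a point of `T_p` is a closed
ball of radius `p ^ t` in `ℚ_p` together with the number `t`, its height. The vertices are the
points of integral height; the edge from a vertex to its parent leads from a ball of radius `p ^ n`
to the ball of radius `p ^ (n + 1)` which contains it. -/
def PadicTree (p : ℕ) [Fact p.Prime] : Type := SeparationQuotient (BallData p)

namespace PadicTree

variable {p : ℕ} [hp : Fact p.Prime]

noncomputable instance : MetricSpace (PadicTree p) :=
  inferInstanceAs (MetricSpace (SeparationQuotient (BallData p)))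

/-- The ball of radius `p ^ t` around `x`. -/
noncomputable def mk (x : ℚ_[p]) (t : ℝ) : PadicTree p := SeparationQuotient.mk ⟨x, t⟩

theorem mk_surjective (v : PadicTree p) : ∃ x t, v = mk x t := by
  obtain ⟨⟨x, t⟩, rfl⟩ := SeparationQuotient.surjective_mk v
  exact ⟨x, t, rfl⟩

theorem dist_mk (x y : ℚ_[p]) (s t : ℝ) :
    dist (mk x s) (mk y t) = dist (⟨x, s⟩ : BallData p) ⟨y, t⟩ :=
  SeparationQuotient.dist_mk _ _

theorem mk_eq_mk {x y : ℚ_[p]} {s t : ℝ} :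
    mk x s = mk y t ↔ s = t ∧ ‖x - y‖ ≤ (p : ℝ) ^ s := by
  rw [← dist_eq_zero, dist_mk, BallData.dist_eq_zero_iff]

/-- The height of a point. -/
noncomputable def height : PadicTree p → ℝ :=
  SeparationQuotient.lift BallData.t fun a b h =>
    ((BallData.dist_eq_zero_iff a b).1 (Metric.inseparable_iff.1 h)).1

theorem height_mk (x : ℚ_[p]) (t : ℝ) : height (mk x t) = t := rfl

/-- The Busemann function of the tree about the distinguished point at infinity. -/
noncomputable def busemann (v : PadicTree p) : ℝ := -height v

/-- `busemann` is the Busemann function `lim (d(γ s, v) - s)` of the line `γ s = mk 0 s`. -/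
theorem tendsto_busemann (v : PadicTree p) :
    Filter.Tendsto (fun s : ℝ => dist (mk 0 s) v - s) Filter.atTop (𝓝 (busemann v)) := by
  obtain ⟨x, t, rfl⟩ := mk_surjective v
  refine tendsto_const_nhds.congr' ?_
  have h1 := (Filter.tendsto_atTop.1 (tendsto_rpow_atTop_of_base_gt_one (p : ℝ) BallData.one_lt)
    ‖(0 : ℚ_[p]) - x‖)
  filter_upwards [h1, Filter.eventually_ge_atTop t] with s h2 h3
  have h4 : BallData.merge (⟨0, s⟩ : BallData p) ⟨x, t⟩ = s :=
    le_antisymm (BallData.merge_le_iff.2 ⟨le_rfl, h3, h2⟩) (BallData.merge_spec (⟨0, s⟩ : BallData p) ⟨x, t⟩).1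
  rw [dist_mk, BallData.dist_def, h4, busemann, height_mk]
  ring

/-- The graph of vertices and edges of the tree. -/
noncomputable def vertexGraph (p : ℕ) [Fact p.Prime] :
    SimpleGraph {v : PadicTree p // ∃ n : ℤ, height v = n} where
  Adj u v := dist u v = 1
  symm := ⟨fun u v h => by rwa [dist_comm]⟩
  loopless := ⟨fun u h => by simp at h⟩

/-- The ball of radius `p ^ n` around `x`, as a vertex. -/
noncomputable def vertex (x : ℚ_[p]) (n : ℤ) : {v : PadicTree p // ∃ n : ℤ, height v = n} :=
  ⟨mk x n, n, rfl⟩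

theorem vertex_surjective (v : {v : PadicTree p // ∃ n : ℤ, height v = n}) :
    ∃ x n, v = vertex x n := by
  obtain ⟨v, n, hv⟩ := v
  obtain ⟨x, t, rfl⟩ := mk_surjective v
  obtain rfl : t = n := hv
  exact ⟨x, n, rfl⟩

theorem vertex_eq_vertex {x y : ℚ_[p]} {m n : ℤ} :
    vertex x m = vertex y n ↔ m = n ∧ ‖x - y‖ ≤ (p : ℝ) ^ m := by
  rw [vertex, vertex, Subtype.mk_eq_mk, mk_eq_mk, Int.cast_inj, Real.rpow_intCast]

/-- Adjacency: one of the balls is the parent of the other. -/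
theorem adj_iff {x y : ℚ_[p]} {m n : ℤ} : (vertexGraph p).Adj (vertex x m) (vertex y n) ↔
    (n = m + 1 ∧ ‖x - y‖ ≤ (p : ℝ) ^ n) ∨ (m = n + 1 ∧ ‖x - y‖ ≤ (p : ℝ) ^ m) := by
  change dist (mk x m) (mk y n) = 1 ↔ _
  obtain ⟨h1, h2, h3⟩ := BallData.merge_spec (⟨x, m⟩ : BallData p) ⟨y, n⟩
  obtain ⟨k, hk⟩ : ∃ k : ℤ, BallData.merge (⟨x, m⟩ : BallData p) ⟨y, n⟩ = k := by
    have e : ∀ j : ℤ, Real.logb p ((p : ℝ) ^ j) = j := fun j => by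
      rw [← Real.rpow_intCast, Real.logb_rpow BallData.pos BallData.one_lt.ne']
    unfold BallData.merge
    rcases max_choice (max ((p : ℝ) ^ (m : ℝ)) ((p : ℝ) ^ (n : ℝ))) ‖x - y‖ with h | h
    · rcases max_choice ((p : ℝ) ^ (m : ℝ)) ((p : ℝ) ^ (n : ℝ)) with h' | h'
      · exact ⟨m, by rw [h, h', Real.rpow_intCast, e]⟩
      · exact ⟨n, by rw [h, h', Real.rpow_intCast, e]⟩
    · have h0 : x - y ≠ 0 := by
        intro h0
        rw [h0, norm_zero] at h
        exact (lt_max_of_lt_left (lt_max_of_lt_left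
          (Real.rpow_pos_of_pos (BallData.pos (p := p)) _))).ne' h
      exact ⟨-(x - y).valuation, by rw [h, Padic.norm_eq_zpow_neg_valuation h0, e]⟩
  rw [dist_mk, BallData.dist_def, hk]
  rw [hk] at h1 h2 h3
  simp only at h1 h2 h3 ⊢
  rw [Real.rpow_intCast] at h3
  constructor
  · intro h
    have h' : (k - m) + (k - n) = 1 := by exact_mod_cast h
    have h1' : m ≤ k := by exact_mod_cast h1
    have h2' : n ≤ k := by exact_mod_cast h2
    rcases (by omega : (k = n ∧ n = m + 1) ∨ (k = m ∧ m = n + 1)) with ⟨rfl, e⟩ | ⟨rfl, e⟩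
    · exact Or.inl ⟨e, h3⟩
    · exact Or.inr ⟨e, h3⟩
  · have key : ∀ j : ℤ, m ≤ j → n ≤ j → ‖x - y‖ ≤ (p : ℝ) ^ j → k ≤ j := by
      intro j hm hn hj
      have := (BallData.merge_le_iff (a := (⟨x, m⟩ : BallData p)) (b := ⟨y, n⟩) (h := j)).2
        ⟨Int.cast_le.2 hm, Int.cast_le.2 hn, by rwa [Real.rpow_intCast]⟩
      rw [hk] at this
      exact_mod_cast this
    have h1' : m ≤ k := by exact_mod_cast h1
    have h2' : n ≤ k := by exact_mod_cast h2
    rintro (⟨e, h⟩ | ⟨e, h⟩)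
    · have : k = n := le_antisymm (key n (by omega) le_rfl h) h2'
      subst this; subst e; push_cast; ring
    · have : k = m := le_antisymm (key m le_rfl (by omega) h) h1'
      subst this; subst e; push_cast; ring

theorem adj_parent (x : ℚ_[p]) (n : ℤ) :
    (vertexGraph p).Adj (vertex x n) (vertex x (n + 1)) :=
  adj_iff.2 (Or.inl ⟨rfl, by simpa using (zpow_pos (BallData.pos (p := p)) _).le⟩)

/-- The graph of vertices and edges is a tree. -/
theorem vertexGraph_isTree : (vertexGraph p).IsTree := by
  classical
  have climb : ∀ (x : ℚ_[p]) (n : ℤ) (j : ℕ),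
      (vertexGraph p).Reachable (vertex x n) (vertex x (n + j)) := by
    intro x n j
    induction j with
    | zero => simp
    | succ j ih =>
      refine ih.trans ?_
      have := (adj_parent x (n + j)).reachable
      simpa [add_assoc] using this
  refine ⟨?_, ?_⟩
  · refine (SimpleGraph.connected_iff _).2 ⟨?_, ⟨vertex 0 0⟩⟩
    intro u v
    obtain ⟨x, m, rfl⟩ := vertex_surjective u
    obtain ⟨y, n, rfl⟩ := vertex_surjective v
    obtain ⟨N, hN⟩ := pow_unbounded_of_one_lt ‖x - y‖ (BallData.one_lt (p := p))
    obtain ⟨k, hk1, hk2, hk3⟩ : ∃ k : ℤ, m ≤ k ∧ n ≤ k ∧ (N : ℤ) ≤ k :=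
      ⟨max m (max n N), by simp, by simp, by simp⟩
    obtain ⟨i, rfl⟩ := Int.le.dest hk1
    obtain ⟨j, hj⟩ := Int.le.dest hk2
    have e : vertex x (m + i) = vertex y (n + j) := by
      refine vertex_eq_vertex.2 ⟨hj.symm, hN.le.trans ?_⟩
      rw [← zpow_natCast]
      exact zpow_le_zpow_right₀ BallData.one_lt.le hk3
    exact (climb x m i).trans (e ▸ (climb y n j).symm)
  · intro v c hc
    obtain ⟨w, hw, hmin⟩ := c.support.toFinset.exists_min_image (fun w => height w.1)
      ⟨v, by simp⟩
    simp only [List.mem_toFinset] at hw hmin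
    have hc' := hc.rotate hw
    refine hc'.snd_ne_penultimate ?_
    have hsup : ∀ u, u ∈ (c.rotate w hw).support → height w.1 ≤ height u.1 := by
      intro u hu
      refine hmin u ?_
      exact (SimpleGraph.Walk.mem_support_rotate_iff c w hw).1 hu
    have hadj1 := (c.rotate w hw).adj_snd hc'.not_nil
    have hadj2 := ((c.rotate w hw).adj_penultimate hc'.not_nil).symm
    have hup : ∀ u u', (vertexGraph p).Adj w u → (vertexGraph p).Adj w u' →
        height w.1 ≤ height u.1 → height w.1 ≤ height u'.1 → u = u' := by
      intro u u'
      obtain ⟨x, m, rfl⟩ := vertex_surjective w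
      obtain ⟨y, n, rfl⟩ := vertex_surjective u
      obtain ⟨z, k, rfl⟩ := vertex_surjective u'
      intro h1 h2 h3 h4
      have h3' : m ≤ n := by
        have : (m : ℝ) ≤ n := h3
        exact_mod_cast this
      have h4' : m ≤ k := by
        have : (m : ℝ) ≤ k := h4
        exact_mod_cast this
      rcases adj_iff.1 h1 with ⟨rfl, h5⟩ | ⟨h5, -⟩
      · rcases adj_iff.1 h2 with ⟨rfl, h6⟩ | ⟨h6, -⟩
        · refine vertex_eq_vertex.2 ⟨rfl, ?_⟩
          have := Padic.nonarchimedean (y - x) (x - z)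
          rw [sub_add_sub_cancel, norm_sub_rev y x] at this
          exact this.trans (max_le h5 h6)
        · omega
      · omega
    exact hup _ _ hadj1 hadj2 (hsup _ (SimpleGraph.Walk.getVert_mem_support _ _))
      (hsup _ (SimpleGraph.Walk.getVert_mem_support _ _))

/-- Every vertex has exactly `p + 1` neighbours. -/
theorem vertexGraph_degree (v : {v : PadicTree p // ∃ n : ℤ, height v = n}) :
    ((vertexGraph p).neighborSet v).ncard = p + 1 := by
  obtain ⟨x, n, rfl⟩ := vertex_surjective v
  have hp0 : (p : ℚ_[p]) ≠ 0 := by exact_mod_cast hp.out.ne_zero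
  let f : Option (Fin p) → {v : PadicTree p // ∃ n : ℤ, height v = n} := fun o =>
    o.elim (vertex x (n + 1)) fun i => vertex (x + (i : ℕ) * (p : ℚ_[p]) ^ (-n)) (n - 1)
  have hnorm : ∀ (k : ℤ) (a : ℚ_[p]), ‖a * (p : ℚ_[p]) ^ (-n)‖ ≤ (p : ℝ) ^ (n + k) ↔
      ‖a‖ ≤ (p : ℝ) ^ k := by
    intro k a
    have h0 := zpow_pos (BallData.pos (p := p)) n
    rw [norm_mul, Padic.norm_p_zpow, neg_neg, add_comm, zpow_add₀ BallData.pos.ne',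
      mul_le_mul_iff_left₀ h0]
  have hlt : ∀ a : ℤ_[p], ‖(a : ℚ_[p])‖ ≤ (p : ℝ) ^ (-1 : ℤ) ↔ a ∈ IsLocalRing.maximalIdeal ℤ_[p] := by
    intro a
    rw [IsLocalRing.mem_maximalIdeal, PadicInt.mem_nonunits, ← PadicInt.norm_def]
    exact (PadicInt.norm_le_pow_iff_norm_lt_pow_add_one a (-1)).trans (by simp)
  have hinj : Function.Injective f := by
    rintro (_ | i) (_ | j) h
    · rfl
    · have := (vertex_eq_vertex.1 h).1
      omega
    · have := (vertex_eq_vertex.1 h).1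
      omega
    · have h2 := (vertex_eq_vertex.1 h).2
      rw [add_sub_add_left_eq_sub, ← sub_mul, sub_eq_add_neg n 1, hnorm] at h2
      obtain ⟨k, hk, hu⟩ := PadicInt.existsUnique_mem_range (p := p) ((i : ℕ) : ℤ_[p])
      have hi := hu i ⟨i.2, by simp⟩
      have hj := hu j ⟨j.2, (hlt _).1 (by push_cast; exact h2)⟩
      exact congrArg some (Fin.ext (hi.trans hj.symm))
  have hrange : (vertexGraph p).neighborSet (vertex x n) = Set.range f := by
    ext w
    obtain ⟨y, m, rfl⟩ := vertex_surjective w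
    rw [SimpleGraph.mem_neighborSet, adj_iff]
    constructor
    · rintro (⟨rfl, h⟩ | ⟨rfl, h⟩)
      · exact ⟨none, vertex_eq_vertex.2 ⟨rfl, h⟩⟩
      · have hz : ‖(y - x) * (p : ℚ_[p]) ^ (m + 1)‖ ≤ 1 := by
          rw [← zpow_zero (p : ℝ), ← hnorm, mul_assoc, ← zpow_add₀ hp0, add_neg_cancel, zpow_zero,
            mul_one, norm_sub_rev, add_zero]
          exact h
        obtain ⟨z, hzz⟩ : ∃ z : ℤ_[p], (z : ℚ_[p]) = (y - x) * (p : ℚ_[p]) ^ (m + 1) :=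
          ⟨⟨_, hz⟩, rfl⟩
        obtain ⟨i, ⟨hi, hu⟩, -⟩ := PadicInt.existsUnique_mem_range z
        refine ⟨some ⟨i, hi⟩, vertex_eq_vertex.2 ⟨by omega, ?_⟩⟩
        have := (hlt _).2 hu
        rw [← hnorm, ← norm_neg] at this
        refine le_of_eq_of_le (congrArg _ ?_) this
        rw [PadicInt.coe_sub, PadicInt.coe_natCast, hzz, sub_mul, mul_assoc, ← zpow_add₀ hp0, add_neg_cancel, zpow_zero]
        ring
    · rintro ⟨_ | i, h⟩
      · obtain ⟨h1, h2⟩ := vertex_eq_vertex.1 h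
        exact Or.inl ⟨h1.symm, h1 ▸ h2⟩
      · obtain ⟨h1, h2⟩ := vertex_eq_vertex.1 h
        refine Or.inr ⟨by omega, ?_⟩
        have h3 : ‖((i : ℕ) : ℚ_[p]) * (p : ℚ_[p]) ^ (-n)‖ ≤ (p : ℝ) ^ (n + 0) := by
          rw [hnorm, zpow_zero]
          exact_mod_cast Padic.norm_int_le_one (p := p) (i : ℕ)
        have := Padic.nonarchimedean (-(((i : ℕ) : ℚ_[p]) * (p : ℚ_[p]) ^ (-n)))
          (x + (i : ℕ) * (p : ℚ_[p]) ^ (-n) - y)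
        rw [norm_neg, add_zero] at *
        refine le_of_eq_of_le (congrArg _ (by ring)) (this.trans (max_le h3 (h2.trans ?_)))
        exact zpow_le_zpow_right₀ BallData.one_lt.le (by omega)
  rw [hrange, ← Nat.card_coe_set_eq, Nat.card_range_of_injective hinj]
  simp

/-- Every point lies on an edge of length one. -/
theorem exists_edge (v : PadicTree p) : ∃ a b, (vertexGraph p).Adj a b ∧
    dist a.1 v + dist v b.1 = 1 := by
  obtain ⟨x, t, rfl⟩ := mk_surjective v
  refine ⟨vertex x ⌊t⌋, vertex x (⌊t⌋ + 1), adj_parent _ _, ?_⟩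
  have key : ∀ s t : ℝ, s ≤ t → dist (mk x s) (mk x t) = t - s := by
    intro s t h
    have h4 : BallData.merge (⟨x, s⟩ : BallData p) ⟨x, t⟩ = t :=
      le_antisymm (BallData.merge_le_iff.2 ⟨h, le_rfl, by
        simpa using (Real.rpow_pos_of_pos (BallData.pos (p := p)) _).le⟩)
      (BallData.merge_spec (⟨x, s⟩ : BallData p) ⟨x, t⟩).2.1
    rw [dist_mk, BallData.dist_def, h4]
    ring
  have h1 := Int.floor_le t
  have h2 := (Int.lt_floor_add_one t).le
  rw [vertex, vertex, key _ _ h1, key _ _ (by push_cast; exact h2)]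
  push_cast
  ring

end PadicTree

/-! ### The mixed millefeuille space `ℍ²_p[p]` and the group `G_p` -/

/-- The mixed millefeuille space `ℍ²_p[p]`. -/
abbrev MillefeuillePlane (p : ℕ) [Fact p.Prime] : Type :=
  Millefeuille (HeintzePlane.busemann (p := p)) (PadicTree.busemann (p := p))

/-- The underlying set of the horocyclic product `ℍ²_p[p] ⋈ ℍ²_p[p]`. -/
abbrev HorocyclicPlanes (p : ℕ) [Fact p.Prime] : Type :=
  Horocyclic (Millefeuille.busemann : MillefeuillePlane p → ℝ)
    (Millefeuille.busemann : MillefeuillePlane p → ℝ)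

/-- The ring `ℤ[1/p]`. -/
abbrev ZInv (p : ℕ) : Type := Localization.Away (p : ℤ)

/-- The element `1/p` of `ℤ[1/p]`. -/
noncomputable def pInv (p : ℕ) : ZInv p := IsLocalization.Away.invSelf (p : ℤ)

theorem mul_pInv (p : ℕ) : (p : ZInv p) * pInv p = 1 := by
  simpa [pInv] using IsLocalization.Away.mul_invSelf (S := ZInv p) (p : ℤ)

/-- The matrix `diag(p, 1/p)` in `GL₂(ℤ[1/p])`. -/
noncomputable def diagMatrix (p : ℕ) : GL (Fin 2) (ZInv p) where
  val := !![(p : ZInv p), 0; 0, pInv p]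
  inv := !![pInv p, 0; 0, (p : ZInv p)]
  val_inv := by
    simp [mul_pInv, mul_comm (pInv p), Matrix.one_fin_two]
  inv_val := by
    simp [mul_pInv, mul_comm (pInv p), Matrix.one_fin_two]

/-- The automorphism `v ↦ A v` of the additive group `R²`. -/
def matrixAut {R : Type*} [CommRing R] (A : GL (Fin 2) R) :
    MulAut (Multiplicative (Fin 2 → R)) :=
  AddEquiv.toMultiplicative
    { toFun := fun v => (A : Matrix (Fin 2) (Fin 2) R).mulVec v
      invFun := fun v => ((A⁻¹ : GL (Fin 2) R) : Matrix (Fin 2) (Fin 2) R).mulVec v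
      left_inv := fun v => by
        beta_reduce
        rw [Matrix.mulVec_mulVec, ← Units.val_mul, inv_mul_cancel, Units.val_one, Matrix.one_mulVec]
      right_inv := fun v => by
        beta_reduce
        rw [Matrix.mulVec_mulVec, ← Units.val_mul, mul_inv_cancel, Units.val_one, Matrix.one_mulVec]
      map_add' := fun v w => Matrix.mulVec_add _ v w }

/-- The group `G_p = ℤ[1/p]² ⋊_A ℤ`, in which `n : ℤ` acts on `ℤ[1/p]²` by `A ^ n`. -/
abbrev Gp (p : ℕ) (A : GL (Fin 2) (ZInv p)) : Type :=
  Multiplicative (Fin 2 → ZInv p) ⋊[zpowersHom _ (matrixAut A)] Multiplicative ℤ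

end HorocyclicSol

/-! The ring `ℤ[1/p]`, embedded diagonally, is a cocompact lattice in `ℝ × ℚ_p`. It is discrete
because a `p`-adic bound limits the denominator and a real bound then limits the numerator
(`ZInv.finite_of_bounded`). It is cocompact because `p`-adic approximation by fractions `n / p ^ k`,
followed by an integral correction, moves any point into `[0, 1] × ℤ_p` (`ZInv.exists_sub_mem`).

A point of `ℍ²_p[p]` is given by a real `x`, a `p`-adic `ξ` and a height `t`, where `ξ` matters only
modulo the ball of radius `p ^ t`. The maps `x ↦ a + p ^ n * x`, `ξ ↦ α + p ^ (-n) * ξ`, `t ↦ n + t`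
are isometries: as `|p ^ (-n)|_p = p ^ n`, both places are stretched by the same factor. In
eigencoordinates `(v₀, v₁)` of `A`, obtained from the conjugating matrix `P`, the first factor
receives `v₀` at the real place and `v₁` at the `p`-adic place, and the second factor receives the
two other combinations. Thus `A ^ k` changes the two heights by opposite amounts, and the horocyclic
product is preserved.

Properness: admissibility of `N` bounds both factor distances by twice `d_N`. In a factor, a bounded
distance bounds `x` and `t` by hyperbolic geometry, and `ξ` because a short path in the tree cannot
climb far enough to leave a given ball (`PadicTree.norm_sub_le_of_path`). Hence a group element that
moves a bounded set to meet itself has both eigencoordinates bounded at both places and a bounded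
`ℤ`-component, which leaves finitely many.

Coboundedness: the `ℤ`-component brings the first height into `[0, 1]`, and the lattice then brings
all four coordinates into unit balls. Any two points of the resulting set are joined by a path that
returns to height `0` halfway and changes sheets there. It is Lipschitz in both factors, so
monotonicity and `N (1, 1) = 1` bound its `N`-length. -/

namespace HorocyclicSol

/-! ### Metric estimates in the hyperbolic plane. -/

namespace HeintzePlane

variable {p : ℕ} [hp : Fact p.Prime]

theorem log_im_toUpperHalfPlane (a : HeintzePlane p) :
    Real.log a.toUpperHalfPlane.im = a.t * Real.log p :=
  Real.log_rpow BallData.pos _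

theorem abs_sub_t_le_dist (a b : HeintzePlane p) : |a.t - b.t| ≤ dist a b := by
  rw [dist_def, le_div_iff₀ log_pos]
  have h := UpperHalfPlane.dist_log_im_le a.toUpperHalfPlane b.toUpperHalfPlane
  rwa [log_im_toUpperHalfPlane, log_im_toUpperHalfPlane, Real.dist_eq, ← sub_mul, abs_mul,
    abs_of_pos log_pos] at h

theorem dist_vertical (x s t : ℝ) : dist (⟨x, s⟩ : HeintzePlane p) ⟨x, t⟩ = |s - t| := by
  rw [dist_def, UpperHalfPlane.dist_of_re_eq (by rfl), log_im_toUpperHalfPlane,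
    log_im_toUpperHalfPlane, Real.dist_eq, ← sub_mul, abs_mul, abs_of_pos log_pos,
    mul_div_cancel_right₀ _ log_pos.ne']

theorem dist_horizontal_le (x y t : ℝ) :
    dist (⟨x, t⟩ : HeintzePlane p) ⟨y, t⟩ ≤ (p : ℝ) ^ (-t) * |x - y| := by
  have ht : 0 < (p : ℝ) ^ t := Real.rpow_pos_of_pos BallData.pos _
  rw [dist_def, div_le_iff₀ log_pos]
  refine (UpperHalfPlane.dist_le_dist_coe_div_sqrt _ _).trans (le_of_eq ?_)
  have h : dist (toUpperHalfPlane (⟨x, t⟩ : HeintzePlane p) : ℂ)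
      (toUpperHalfPlane (⟨y, t⟩ : HeintzePlane p) : ℂ) = Real.log p * |x - y| := by
    rw [Complex.dist_of_im_eq (by rfl), Real.dist_eq]
    change |Real.log p * x - Real.log p * y| = _
    rw [← mul_sub, abs_mul, abs_of_pos log_pos]
  rw [h]
  change _ / √((p : ℝ) ^ t * (p : ℝ) ^ t) = _
  rw [Real.sqrt_mul_self ht.le, Real.rpow_neg BallData.pos.le]
  field_simp

/-- A hyperbolic ball lies in a Euclidean ball around the same centre, with radius proportional to
the height of the centre in the half plane; only the real part is kept. -/
theorem log_mul_abs_sub_x_le (a b : HeintzePlane p) :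
    Real.log p * |a.x - b.x| ≤ (p : ℝ) ^ b.t * (Real.exp (Real.log p * dist a b) - 1) := by
  have h := UpperHalfPlane.dist_coe_le a.toUpperHalfPlane b.toUpperHalfPlane
  have h' := (Complex.abs_re_le_norm _).trans ((dist_eq_norm _ _).symm.trans_le h)
  rw [dist_def, mul_div_cancel₀ _ log_pos.ne']
  refine le_trans (le_of_eq ?_) h'
  change _ = |Real.log p * a.x - Real.log p * b.x|
  rw [← mul_sub, abs_mul, abs_of_pos log_pos]

end HeintzePlane

/-! ### Paths in the tree. -/

namespace PadicTree

variable {p : ℕ} [hp : Fact p.Prime]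

theorem dist_mk_same (x : ℚ_[p]) (s t : ℝ) : dist (mk x s) (mk x t) = |s - t| := by
  wlog h : s ≤ t generalizing s t
  · rw [dist_comm, this _ _ (le_of_not_ge h), abs_sub_comm]
  have h4 : BallData.merge (⟨x, s⟩ : BallData p) ⟨x, t⟩ = t :=
    le_antisymm (BallData.merge_le_iff.2 ⟨h, le_rfl, by
      simpa using (Real.rpow_pos_of_pos (BallData.pos (p := p)) _).le⟩)
    (BallData.merge_spec (⟨x, s⟩ : BallData p) ⟨x, t⟩).2.1
  rw [dist_mk, BallData.dist_def, h4, abs_of_nonpos (by linarith)]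
  simp

theorem continuous_mk (x : ℚ_[p]) : Continuous (mk x) :=
  (Isometry.of_dist_eq fun s t => dist_mk_same x s t).continuous

/-- A path which stays below the height `h` stays in the same ball of radius `p ^ h`. -/
theorem norm_sub_le_of_path {ξ η : ℚ_[p]} {s t M h : ℝ} (δ : Path (mk ξ s) (mk η t)) (hM : M < h)
    (hδ : ∀ u, height (δ u) ≤ M) : ‖ξ - η‖ ≤ (p : ℝ) ^ h := by
  -- The truth of `P` will be locally constant along the path: two points of height at most `M` at
  -- distance less than `h - M` merge below the height `h`. Connectedness of the interval then
  -- carries `P` from the source to the target.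
  let P : PadicTree p → Prop := fun v => ∃ x r, v = mk x r ∧ ‖ξ - x‖ ≤ (p : ℝ) ^ h
  have hmono : ∀ r, r ≤ h → (p : ℝ) ^ r ≤ (p : ℝ) ^ h := fun r hr =>
    (Real.rpow_le_rpow_left_iff BallData.one_lt).2 hr
  have key : ∀ v w, height v ≤ M → height w ≤ M → dist v w < h - M → P v → P w := by
    rintro _ w hv hw hd ⟨x, r, rfl, hx⟩
    obtain ⟨y, q, rfl⟩ := mk_surjective w
    rw [height_mk] at hv hw
    obtain ⟨h1, h2, h3⟩ := BallData.merge_spec (⟨x, r⟩ : BallData p) ⟨y, q⟩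
    rw [dist_mk, BallData.dist_def] at hd
    simp only at h1 h2 h3 hd
    refine ⟨y, q, rfl, ?_⟩
    have h4 := Padic.nonarchimedean (ξ - x) (x - y)
    rw [sub_add_sub_cancel] at h4
    exact h4.trans (max_le hx (h3.trans (hmono _ (by linarith))))
  have hloc : IsLocallyConstant fun u => P (δ u) := by
    rw [IsLocallyConstant.iff_eventually_eq]
    intro u
    have h1 : ∀ᶠ v in 𝓝 u, dist (δ v) (δ u) < h - M :=
      (δ.continuous.tendsto u).eventually (Metric.ball_mem_nhds _ (by linarith))
    filter_upwards [h1] with v hv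
    exact propext ⟨key _ _ (hδ _) (hδ _) hv,
      key _ _ (hδ _) (hδ _) (by rwa [dist_comm])⟩
  have h01 := hloc.apply_eq_of_preconnectedSpace 0 1
  rw [δ.source, δ.target] at h01
  have ht : t ≤ M := by simpa [height_mk] using hδ 1
  obtain ⟨x, r, hxr, hx⟩ : P (mk η t) :=
    h01 ▸ ⟨ξ, s, rfl, by simpa using (Real.rpow_pos_of_pos (BallData.pos (p := p)) _).le⟩
  have h5 := (mk_eq_mk.1 hxr).2
  have h4 := Padic.nonarchimedean (ξ - x) (x - η)
  rw [sub_add_sub_cancel, norm_sub_rev x η] at h4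
  exact h4.trans (max_le hx (h5.trans (hmono _ (by linarith))))

end PadicTree

/-! ### The length metric of a millefeuille space. -/

namespace Millefeuille

variable {X T : Type*} {βX : X → ℝ} {βT : T → ℝ} [PseudoEMetricSpace X] [TopologicalSpace T]

theorem edist_fst_le (a b : Millefeuille βX βT) : edist a.fst b.fst ≤ edist a b := by
  refine le_iInf₂ fun γ δ => le_iInf fun _ => ?_
  simpa using eVariationOn.edist_le γ (Set.mem_univ (0 : I)) (Set.mem_univ (1 : I))

theorem edist_le_of_lipschitz {a b : Millefeuille βX βT} {K : ℝ≥0} {F : ℝ → X} {G : ℝ → T}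
    (hF : LipschitzWith K F) (hG : Continuous G) (h : ∀ u, βX (F u) = βT (G u))
    (hF0 : F 0 = a.fst) (hF1 : F 1 = b.fst) (hG0 : G 0 = a.snd) (hG1 : G 1 = b.snd) :
    edist a b ≤ K := by
  let γ : Path a.fst b.fst :=
    { toFun := fun u => F u
      continuous_toFun := hF.continuous.comp continuous_subtype_val
      source' := hF0
      target' := hF1 }
  let δ : Path a.snd b.snd :=
    { toFun := fun u => G u
      continuous_toFun := hG.comp continuous_subtype_val
      source' := hG0
      target' := hG1 }
  refine (iInf₂_le γ δ).trans ((iInf_le _ fun t => h _).trans ?_)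
  have h1 : eVariationOn (F ∘ (Subtype.val : I → ℝ)) Set.univ ≤
      K * eVariationOn (Subtype.val : I → ℝ) Set.univ :=
    (hF.lipschitzOnWith (s := Set.univ)).comp_eVariationOn_le (Set.mapsTo_univ _ _)
  have h2 : eVariationOn (Subtype.val : I → ℝ) Set.univ ≤ 1 := by
    have := MonotoneOn.eVariationOn_eq (f := (Subtype.val : I → ℝ)) (s := Set.univ)
      (fun _ _ _ _ h => h) (Set.mem_univ 0) (Set.mem_univ 1)
    have e : Set.univ ∩ Set.Icc (0 : I) 1 = Set.univ :=
      Set.eq_univ_of_forall fun u => ⟨trivial, u.2⟩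
    rw [e] at this
    simp [this]
  exact h1.trans (by simpa using mul_le_mul_right h2 (K : ℝ≥0∞))

end Millefeuille

/-! ### Coordinates and distance estimates in `ℍ²_p[p]`. -/

namespace MillefeuillePlane

variable {p : ℕ} [hp : Fact p.Prime]

/-- The point of `ℍ²_p[p]` over `x : ℝ` and `ξ : ℚ_p` at the height `t`. -/
noncomputable def pt (x : ℝ) (ξ : ℚ_[p]) (t : ℝ) : MillefeuillePlane p :=
  ⟨⟨x, t⟩, PadicTree.mk ξ t, rfl⟩

theorem busemann_pt (x : ℝ) (ξ : ℚ_[p]) (t : ℝ) : Millefeuille.busemann (pt x ξ t) = -t := rfl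

theorem pt_surjective (z : MillefeuillePlane p) : ∃ x ξ t, z = pt x ξ t := by
  obtain ⟨⟨x, t⟩, v, h⟩ := z
  obtain ⟨ξ, s, rfl⟩ := PadicTree.mk_surjective v
  obtain rfl : t = s := neg_injective h
  exact ⟨x, ξ, t, rfl⟩

theorem pt_eq_pt {x y : ℝ} {ξ η : ℚ_[p]} {s t : ℝ} :
    pt x ξ s = pt y η t ↔ x = y ∧ s = t ∧ ‖ξ - η‖ ≤ (p : ℝ) ^ s := by
  rw [Millefeuille.ext_iff, HeintzePlane.ext_iff]
  change (x = y ∧ s = t) ∧ PadicTree.mk ξ s = PadicTree.mk η t ↔ _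
  rw [PadicTree.mk_eq_mk]
  tauto

theorem edist_pt_vertical (x : ℝ) (ξ : ℚ_[p]) (s t : ℝ) :
    edist (pt x ξ s) (pt x ξ t) = ENNReal.ofReal |s - t| := by
  refine le_antisymm ?_ ?_
  · refine Millefeuille.edist_le_of_lipschitz (K := Real.toNNReal |s - t|)
      (F := fun u => ⟨x, s + u * (t - s)⟩) (G := fun u => PadicTree.mk ξ (s + u * (t - s)))
      ?_ ((PadicTree.continuous_mk ξ).comp (by fun_prop)) (fun u => rfl)
      (by simp [pt]) (by simp [pt]) (by simp [pt]) (by simp [pt])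
    refine LipschitzWith.of_dist_le_mul fun u v => ?_
    rw [HeintzePlane.dist_vertical, Real.coe_toNNReal _ (abs_nonneg _), Real.dist_eq, ← abs_mul]
    rw [abs_sub_comm]
    exact le_of_eq (congrArg _ (by ring))
  · refine le_trans (le_of_eq ?_) (Millefeuille.edist_fst_le _ _)
    rw [edist_dist]
    exact congrArg _ (HeintzePlane.dist_vertical x s t).symm

theorem edist_pt_horizontal_le (x y : ℝ) (ξ : ℚ_[p]) (t : ℝ) :
    edist (pt x ξ t) (pt y ξ t) ≤ ENNReal.ofReal ((p : ℝ) ^ (-t) * |x - y|) := by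
  have h0 : 0 ≤ (p : ℝ) ^ (-t) := (Real.rpow_pos_of_pos BallData.pos _).le
  refine Millefeuille.edist_le_of_lipschitz (K := Real.toNNReal ((p : ℝ) ^ (-t) * |x - y|))
    (F := fun u => ⟨x + u * (y - x), t⟩) (G := fun _ => PadicTree.mk ξ t)
    ?_ continuous_const (fun u => rfl)
    (by simp [pt]) (by simp [pt]) (by simp [pt]) (by simp [pt])
  refine LipschitzWith.of_dist_le_mul fun u v => ?_
  refine (HeintzePlane.dist_horizontal_le _ _ _).trans ?_
  rw [Real.coe_toNNReal _ (by positivity), Real.dist_eq, mul_assoc, ← abs_mul, abs_sub_comm]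
  exact le_of_eq (congrArg _ (congrArg _ (by ring)))

theorem edist_pt_le (x y : ℝ) (ξ : ℚ_[p]) (s t : ℝ) : edist (pt x ξ s) (pt y ξ t) ≤
    ENNReal.ofReal (|s - t| + (p : ℝ) ^ (-t) * |x - y|) := by
  have h0 : 0 ≤ (p : ℝ) ^ (-t) := (Real.rpow_pos_of_pos BallData.pos _).le
  rw [ENNReal.ofReal_add (abs_nonneg _) (by positivity)]
  exact (edist_triangle _ (pt x ξ t) _).trans
    (add_le_add (edist_pt_vertical x ξ s t).le (edist_pt_horizontal_le x y ξ t))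

/-- The strict hypothesis provides a path of length less than `L`. It stays at heights at most `s +
L`, which confines it to one ball of radius `p ^ (s + L + 1)`; the `+ 1` is the room that
`norm_sub_le_of_path` requires. The two other bounds hold since the projection to `ℍ²_p` does not
increase distances. -/
theorem of_edist_pt_lt {x y : ℝ} {ξ η : ℚ_[p]} {s t L : ℝ}
    (hL : edist (pt x ξ s) (pt y η t) < ENNReal.ofReal L) :
    |s - t| ≤ L ∧ ‖ξ - η‖ ≤ (p : ℝ) ^ (s + L + 1) ∧
      Real.log p * |x - y| ≤ (p : ℝ) ^ t * (Real.exp (Real.log p * L) - 1) := by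
  have hL0 : 0 < L := by
    by_contra h
    rw [ENNReal.ofReal_of_nonpos (not_lt.1 h)] at hL
    exact not_lt_bot hL
  have hd : dist (⟨x, s⟩ : HeintzePlane p) ⟨y, t⟩ ≤ L := by
    have := (Millefeuille.edist_fst_le (pt x ξ s) (pt y η t)).trans hL.le
    rw [edist_dist] at this
    exact (ENNReal.ofReal_le_ofReal_iff hL0.le).1 this
  refine ⟨(HeintzePlane.abs_sub_t_le_dist _ _).trans hd, ?_, ?_⟩
  · change Millefeuille.pathEDist _ _ < _ at hL
    simp only [Millefeuille.pathEDist, iInf_lt_iff] at hL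
    obtain ⟨γ, δ, h, hlt⟩ := hL
    refine PadicTree.norm_sub_le_of_path δ (M := s + L) (by linarith) fun u => ?_
    have h1 := (eVariationOn.edist_le γ (Set.mem_univ (0 : I)) (Set.mem_univ u)).trans hlt.le
    rw [edist_dist, ENNReal.ofReal_le_ofReal_iff hL0.le, γ.source] at h1
    have h2 := (HeintzePlane.abs_sub_t_le_dist _ _).trans h1
    have h3 : (γ u).t = PadicTree.height (δ u) := neg_injective (h u)
    refine h3.symm.trans_le ?_
    have h4 := (abs_le.1 h2).1
    change -L ≤ s - (γ u).t at h4
    linarith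
  · refine (HeintzePlane.log_mul_abs_sub_x_le (⟨x, s⟩ : HeintzePlane p) ⟨y, t⟩).trans ?_
    have h0 : 0 ≤ (p : ℝ) ^ t := (Real.rpow_pos_of_pos BallData.pos _).le
    have := HeintzePlane.log_pos (p := p)
    gcongr

end MillefeuillePlane

/-! ### Comparison of `N`-lengths with the distances of the factors. -/

namespace Horocyclic

variable {X Y : Type*} [PseudoEMetricSpace X] [PseudoEMetricSpace Y]
  {βX : X → ℝ} {βY : Y → ℝ} {N : Seminorm ℝ (ℝ × ℝ)}

/-- The ball of radius `⊤` is clopen and the interval is connected. This is needed because `toReal`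
sends `⊤` to `0`, which would make lower bounds on the `N`-length useless. -/
theorem edist_ne_top_of_path {x y : X} (γ : Path x y) : edist x y ≠ ⊤ := by
  have h : IsClopen (Metric.eball x ⊤) := ⟨Metric.isClosed_eball_top, Metric.isOpen_eball⟩
  have h1 : IsClopen (γ ⁻¹' Metric.eball x ⊤) := h.preimage γ.continuous
  have h2 : (γ ⁻¹' Metric.eball x ⊤) = Set.univ := h1.eq_univ ⟨0, by simp⟩
  have h3 : (1 : I) ∈ γ ⁻¹' Metric.eball x ⊤ := h2 ▸ Set.mem_univ _
  simp only [Set.mem_preimage, γ.target, Metric.mem_eball] at h3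
  rw [edist_comm]
  exact h3.ne

theorem le_pathLength {x x' : X} {y y' : Y} (γ : Path x x') (δ : Path y y') :
    ENNReal.ofReal (N ((edist x x').toReal, (edist y y').toReal)) ≤ pathLength N γ δ := by
  -- The trivial partition, with a single interval.
  refine le_iSup₂_of_le 1 (fun i => if i = 0 then 0 else 1) (le_iSup_of_le ⟨?_, rfl, rfl⟩ ?_)
  · intro i j hij
    dsimp only
    split_ifs with h1 h2
    · exact le_rfl
    · exact unitInterval.le_one'
    · omega
    · exact le_rfl
  · simp

/-- The factor `2` comes from `N (a, b) ≥ (a + b) / 2` after dropping the other, nonnegative,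
distance. -/
theorem edist_le_of_horoEDist_lt (hN : IsAdmissibleMonotone N) {a b : Horocyclic βX βY} {L : ℝ}
    (h : horoEDist N a b < ENNReal.ofReal L) :
    edist a.fst b.fst < ENNReal.ofReal (2 * L) ∧ edist a.snd b.snd < ENNReal.ofReal (2 * L) := by
  simp only [horoEDist, iInf_lt_iff] at h
  obtain ⟨γ, δ, -, h⟩ := h
  have h1 := (le_pathLength (N := N) γ δ).trans_lt h
  rw [ENNReal.ofReal_lt_ofReal_iff_of_nonneg (apply_nonneg _ _)] at h1
  have h2 := hN.le_apply (edist a.fst b.fst).toReal (edist a.snd b.snd).toReal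
  have h3 : 0 ≤ (edist a.fst b.fst).toReal := ENNReal.toReal_nonneg
  have h4 : 0 ≤ (edist a.snd b.snd).toReal := ENNReal.toReal_nonneg
  constructor
  · rw [← ENNReal.ofReal_toReal (edist_ne_top_of_path γ)]
    exact (ENNReal.ofReal_lt_ofReal_iff_of_nonneg h3).2 (by linarith)
  · rw [← ENNReal.ofReal_toReal (edist_ne_top_of_path δ)]
    exact (ENNReal.ofReal_lt_ofReal_iff_of_nonneg h4).2 (by linarith)

theorem _root_.HorocyclicSol.IsAdmissibleMonotone.apply_le (hN : IsAdmissibleMonotone N)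
    {x y K : ℝ} (hx : 0 ≤ x) (hy : 0 ≤ y) (hxK : x ≤ K) (hyK : y ≤ K) : N (x, y) ≤ K := by
  refine (hN.mono x K y K hx hxK hy hyK).trans (le_of_eq ?_)
  have : ((K, K) : ℝ × ℝ) = K • (1, 1) := by simp
  rw [this, map_smul_eq_mul, hN.apply_one, mul_one, Real.norm_of_nonneg (hx.trans hxK)]

theorem toReal_edist_le_of_lipschitz {f : I → X} {K : ℝ≥0} (hf : LipschitzWith K f) {u v : I}
    (h : u ≤ v) : (edist (f u) (f v)).toReal ≤ K * ((v : ℝ) - u) := by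
  have h0 : (0 : ℝ) ≤ v - u := sub_nonneg.2 h
  have h1 := ENNReal.toReal_mono (by finiteness) (hf u v)
  rwa [ENNReal.toReal_mul, edist_dist u, Subtype.dist_eq, Real.dist_eq, abs_sub_comm,
    abs_of_nonneg h0, ENNReal.toReal_ofReal h0] at h1

/-- Each term of a partition sum is at most `K` times the length of its interval, because `N (K, K)
= K`; the sum telescopes. -/
theorem pathLength_le_of_lipschitz (hN : IsAdmissibleMonotone N) {γ : I → X} {δ : I → Y} {K : ℝ≥0}
    (hγ : LipschitzWith K γ) (hδ : LipschitzWith K δ) : pathLength N γ δ ≤ K := by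
  refine iSup₂_le fun n u => iSup_le fun ⟨hu, hu0, hun⟩ => ?_
  have hu' : ∀ i, (0 : ℝ) ≤ u (i + 1) - u i := fun i => sub_nonneg.2 (hu (Nat.le_succ i))
  calc _ ≤ ∑ i ∈ Finset.range n, ENNReal.ofReal (K * ((u (i + 1) : ℝ) - u i)) :=
        Finset.sum_le_sum fun i _ => ENNReal.ofReal_le_ofReal <|
          hN.apply_le ENNReal.toReal_nonneg ENNReal.toReal_nonneg
            (toReal_edist_le_of_lipschitz hγ (hu (Nat.le_succ i)))
            (toReal_edist_le_of_lipschitz hδ (hu (Nat.le_succ i)))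
    _ = ENNReal.ofReal (∑ i ∈ Finset.range n, K * ((u (i + 1) : ℝ) - u i)) :=
        (ENNReal.ofReal_sum_of_nonneg fun i _ =>
          mul_nonneg K.2 (hu' i)).symm
    _ = K := by
        rw [← Finset.mul_sum, Finset.sum_range_sub (fun i => (u i : ℝ)), hu0, hun]
        simp

theorem horoEDist_map_le {f : X → X} {g : Y → Y} (hf : Isometry f) (hg : Isometry g)
    (h : ∀ x y, βX x = -βY y → βX (f x) = -βY (g y)) {a b a' b' : Horocyclic βX βY}
    (ha : a'.fst = f a.fst) (ha2 : a'.snd = g a.snd)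
    (hb : b'.fst = f b.fst) (hb2 : b'.snd = g b.snd) :
    horoEDist N a' b' ≤ horoEDist N a b := by
  refine le_iInf₂ fun γ δ => le_iInf fun hγδ => ?_
  refine (iInf₂_le ((γ.map hf.continuous).cast ha hb) ((δ.map hg.continuous).cast ha2 hb2)).trans
    ((iInf_le _ fun t => h _ _ (hγδ t)).trans (le_of_eq ?_))
  simp [pathLength, hf.edist_eq, hg.edist_eq]

end Horocyclic

/-! ### Affine isometries of the tree and of `ℍ²_p[p]`. -/

namespace PadicTree

variable {p : ℕ} [hp : Fact p.Prime]

theorem norm_sub_le_max (x y : ℚ_[p]) : ‖x - y‖ ≤ max ‖x‖ ‖y‖ := by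
  simpa [sub_eq_add_neg] using Padic.nonarchimedean x (-y)

/-- Multiplication by `p ^ (-n)` stretches `p`-adic distances by `p ^ n`, so balls of height `h`
become balls of height `n + h`. -/
theorem norm_affine_sub_le_iff (α x y : ℚ_[p]) (n : ℤ) (h : ℝ) :
    ‖(α + (p : ℚ_[p]) ^ (-n) * x) - (α + (p : ℚ_[p]) ^ (-n) * y)‖ ≤ (p : ℝ) ^ (n + h) ↔
      ‖x - y‖ ≤ (p : ℝ) ^ h := by
  rw [add_sub_add_left_eq_sub, ← mul_sub, norm_mul, Padic.norm_p_zpow, neg_neg,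
    Real.rpow_add BallData.pos, Real.rpow_intCast,
    mul_le_mul_iff_right₀ (zpow_pos BallData.pos _)]

/-- The map of the tree induced by the affine map `x ↦ α + p ^ (-n) * x` of `ℚ_p`. -/
noncomputable def affine (α : ℚ_[p]) (n : ℤ) : PadicTree p → PadicTree p :=
  SeparationQuotient.lift
    (fun a : BallData p => mk (α + (p : ℚ_[p]) ^ (-n) * a.x) (n + a.t)) fun a b h => by
      have h := (BallData.dist_eq_zero_iff a b).1 (Metric.inseparable_iff.1 h)
      exact mk_eq_mk.2 ⟨by rw [h.1], (norm_affine_sub_le_iff _ _ _ _ _).2 h.2⟩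

theorem affine_mk (α x : ℚ_[p]) (n : ℤ) (t : ℝ) :
    affine α n (mk x t) = mk (α + (p : ℚ_[p]) ^ (-n) * x) (n + t) := rfl

theorem height_affine (α : ℚ_[p]) (n : ℤ) (v : PadicTree p) :
    height (affine α n v) = n + height v := by
  obtain ⟨x, t, rfl⟩ := mk_surjective v
  rfl

theorem isometry_affine (α : ℚ_[p]) (n : ℤ) : Isometry (affine α n) := by
  refine Isometry.of_dist_eq fun v w => ?_
  obtain ⟨x, s, rfl⟩ := mk_surjective v
  obtain ⟨y, t, rfl⟩ := mk_surjective w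
  have h : BallData.merge (⟨α + (p : ℚ_[p]) ^ (-n) * x, n + s⟩ : BallData p)
      ⟨α + (p : ℚ_[p]) ^ (-n) * y, n + t⟩ =
      n + BallData.merge (⟨x, s⟩ : BallData p) ⟨y, t⟩ := by
    -- The merging height is determined by its upper bounds, which the affine map shifts by `n`.
    refine eq_of_forall_ge_iff fun h => ?_
    rw [← le_sub_iff_add_le', BallData.merge_le_iff, BallData.merge_le_iff]
    simp only [le_sub_iff_add_le']
    rw [← norm_affine_sub_le_iff α x y n (h - n), add_sub_cancel]
  rw [affine_mk, affine_mk, dist_mk, dist_mk, BallData.dist_def, BallData.dist_def, h]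
  ring

end PadicTree

/-- Length is measured in `X` alone, so continuity of `g` suffices. -/
theorem Millefeuille.edist_map_le {X T : Type*} {βX : X → ℝ} {βT : T → ℝ} [PseudoEMetricSpace X]
    [TopologicalSpace T] {f : X → X} {g : T → T} (hf : Isometry f) (hg : Continuous g)
    (h : ∀ x v, βX x = βT v → βX (f x) = βT (g v)) (a b : Millefeuille βX βT) :
    edist (⟨f a.fst, g a.snd, h _ _ a.busemann_eq⟩ : Millefeuille βX βT)
      ⟨f b.fst, g b.snd, h _ _ b.busemann_eq⟩ ≤ edist a b := by
  refine le_iInf₂ fun γ δ => le_iInf fun hγδ => ?_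
  refine (iInf₂_le (γ.map hf.continuous) (δ.map hg)).trans
    ((iInf_le _ fun t => h _ _ (hγδ t)).trans (le_of_eq ?_))
  simp [eVariationOn, hf.edist_eq]

namespace MillefeuillePlane

variable {p : ℕ} [hp : Fact p.Prime]

theorem isometry_mul_left (g : HeintzePlane p) : Isometry (g * ·) :=
  Isometry.of_dist_eq fun a b => HeintzePlane.dist_mul_left g a b

theorem busemann_affine (a : ℝ) (α : ℚ_[p]) (n : ℤ) (x : HeintzePlane p) (v : PadicTree p)
    (h : x.busemann = v.busemann) :
    HeintzePlane.busemann (⟨a, n⟩ * x) = PadicTree.busemann (PadicTree.affine α n v) := by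
  rw [PadicTree.busemann, PadicTree.height_affine, HeintzePlane.mul_def]
  change -(n + x.t) = _
  have : x.t = v.height := neg_injective h
  rw [this]

/-- The map of `ℍ²_p[p]` induced by the affine maps `x ↦ a + p ^ n * x` of `ℝ` and
`ξ ↦ α + p ^ (-n) * ξ` of `ℚ_p`. -/
noncomputable def affine (a : ℝ) (α : ℚ_[p]) (n : ℤ) (z : MillefeuillePlane p) :
    MillefeuillePlane p :=
  ⟨⟨a, n⟩ * z.fst, PadicTree.affine α n z.snd, busemann_affine a α n _ _ z.busemann_eq⟩

theorem affine_pt (a : ℝ) (α : ℚ_[p]) (n : ℤ) (x : ℝ) (ξ : ℚ_[p]) (t : ℝ) :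
    affine a α n (pt x ξ t) =
      pt (a + (p : ℝ) ^ n * x) (α + (p : ℚ_[p]) ^ (-n) * ξ) (n + t) := by
  refine Millefeuille.ext (HeintzePlane.ext ?_ rfl) rfl
  change a + (p : ℝ) ^ (n : ℝ) * x = a + (p : ℝ) ^ n * x
  rw [Real.rpow_intCast]

theorem affine_affine (a b : ℝ) (α β : ℚ_[p]) (m n : ℤ) (z : MillefeuillePlane p) :
    affine a α m (affine b β n z) =
      affine (a + (p : ℝ) ^ m * b) (α + (p : ℚ_[p]) ^ (-m) * β) (m + n) z := by
  obtain ⟨x, ξ, t, rfl⟩ := pt_surjective z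
  have hp0 : (p : ℚ_[p]) ≠ 0 := by exact_mod_cast hp.out.ne_zero
  simp only [affine_pt]
  congr 1
  · rw [zpow_add₀ BallData.pos.ne']
    ring
  · rw [neg_add, zpow_add₀ hp0]
    ring
  · push_cast
    ring

theorem affine_zero (z : MillefeuillePlane p) : affine 0 0 0 z = z := by
  obtain ⟨x, ξ, t, rfl⟩ := pt_surjective z
  simp [affine_pt]

theorem busemann_affine_apply (a : ℝ) (α : ℚ_[p]) (n : ℤ) (z : MillefeuillePlane p) :
    Millefeuille.busemann (affine a α n z) = Millefeuille.busemann z - n := by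
  obtain ⟨x, ξ, t, rfl⟩ := pt_surjective z
  rw [affine_pt, busemann_pt, busemann_pt]
  ring

theorem edist_affine_le (a : ℝ) (α : ℚ_[p]) (n : ℤ) (z w : MillefeuillePlane p) :
    edist (affine a α n z) (affine a α n w) ≤ edist z w :=
  Millefeuille.edist_map_le (isometry_mul_left ⟨a, n⟩)
    (PadicTree.isometry_affine α n).continuous (busemann_affine a α n) z w

/-- `affine a α n` as an isometry. -/
noncomputable def affineIso (a : ℝ) (α : ℚ_[p]) (n : ℤ) :
    MillefeuillePlane p ≃ᵢ MillefeuillePlane p :=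
  have hp0 : (p : ℚ_[p]) ≠ 0 := by exact_mod_cast hp.out.ne_zero
  have hp1 : (p : ℝ) ≠ 0 := BallData.pos.ne'
  have left : ∀ z : MillefeuillePlane p,
      affine (-((p : ℝ) ^ (-n) * a)) (-((p : ℚ_[p]) ^ n * α)) (-n) (affine a α n z) = z := fun z => by
    rw [affine_affine, neg_neg, neg_add_cancel, neg_add_cancel, neg_add_cancel, affine_zero]
  { toFun := affine a α n
    invFun := affine (-((p : ℝ) ^ (-n) * a)) (-((p : ℚ_[p]) ^ n * α)) (-n)
    left_inv := left
    right_inv := fun z => by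
      rw [affine_affine, mul_neg, mul_neg, ← mul_assoc, ← mul_assoc, ← zpow_add₀ hp0,
        ← zpow_add₀ hp1, add_neg_cancel, neg_add_cancel, zpow_zero, zpow_zero, one_mul, one_mul,
        add_neg_cancel, add_neg_cancel, affine_zero]
    isometry_toFun := fun z w => by
      refine le_antisymm (edist_affine_le a α n z w) ?_
      conv_lhs => rw [← left z, ← left w]
      exact edist_affine_le _ _ _ _ _ }

theorem affineIso_apply (a : ℝ) (α : ℚ_[p]) (n : ℤ) (z : MillefeuillePlane p) :
    affineIso a α n z = affine a α n z := rfl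

theorem hasHeightChange_affineIso (a : ℝ) (α : ℚ_[p]) (n : ℤ) :
    HasHeightChange (Millefeuille.busemann : MillefeuillePlane p → ℝ) (affineIso a α n) n :=
  fun z => by rw [affineIso_apply, busemann_affine_apply, sub_sub_cancel]

theorem fixesInfinity_affineIso (a : ℝ) (α : ℚ_[p]) (n : ℤ) :
    FixesInfinity (Millefeuille.busemann : MillefeuillePlane p → ℝ) (affineIso a α n) := by
  refine ⟨fun s => pt 0 0 s, ⟨fun s t _ _ => edist_pt_vertical 0 0 s t, fun s _ => ?_⟩, ?_⟩
  · rw [busemann_pt, busemann_pt]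
    ring
  obtain ⟨M, hM⟩ := pow_unbounded_of_one_lt ‖α‖ (BallData.one_lt (p := p))
  -- The three terms are the legs of a detour: climb by `M`, where the balls around `0` and `α`
  -- coincide; move horizontally by `a`, at a cost of at most `|a|` since the height is nonnegative;
  -- then go vertically to the image point.
  refine ⟨Real.toNNReal M + Real.toNNReal |a| + Real.toNNReal |M - n|, fun s hs => ?_⟩
  have e : (pt a 0 (s + M) : MillefeuillePlane p) = pt a α (s + M) := by
    refine pt_eq_pt.2 ⟨rfl, rfl, ?_⟩
    rw [zero_sub, norm_neg]
    refine hM.le.trans ?_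
    rw [← Real.rpow_natCast]
    exact (Real.rpow_le_rpow_left_iff BallData.one_lt).2 (by linarith)
  rw [affineIso_apply, affine_pt, mul_zero, mul_zero, add_zero, add_zero]
  refine (edist_triangle4 _ (pt 0 0 (s + M)) (pt a 0 (s + M)) _).trans ?_
  push_cast
  refine add_le_add (add_le_add ?_ ?_) ?_
  · rw [edist_pt_vertical]
    refine (congrArg ENNReal.ofReal ?_).le
    rw [sub_add_cancel_left, abs_neg, Nat.abs_cast]
  · refine (edist_pt_horizontal_le _ _ _ _).trans (ENNReal.ofReal_le_ofReal ?_)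
    rw [zero_sub, abs_neg]
    refine mul_le_of_le_one_left (abs_nonneg a) ?_
    exact Real.rpow_le_one_of_one_le_of_nonpos BallData.one_lt.le
      (by have : (0 : ℝ) ≤ M := M.cast_nonneg
          linarith)
  · rw [e, edist_pt_vertical]
    exact (congrArg ENNReal.ofReal (congrArg _ (by ring))).le

/-- A curve which passes from one sheet to another at the height `0`. -/
theorem lipschitzWith_pt {x y : ℝ} {ξ η : ℚ_[p]} {τ : I → ℝ} (hxy : |y - x| ≤ 1)
    (hξη : ‖ξ - η‖ ≤ 1) (hτ : LipschitzWith 2 τ) (hτ1 : ∀ u, -1 ≤ τ u)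
    (hτ0 : ∀ u : I, (u : ℝ) = 1 / 2 → τ u = 0) :
    LipschitzWith (2 + p) fun u : I =>
      pt (x + u * (y - x)) (if (u : ℝ) ≤ 1 / 2 then ξ else η) (τ u) := by
  have key : ∀ (ζ : ℚ_[p]) (u v : I), edist (pt (x + u * (y - x)) ζ (τ u))
      (pt (x + v * (y - x)) ζ (τ v)) ≤ ENNReal.ofReal ((2 + p) * |(u : ℝ) - v|) := by
    intro ζ u v
    refine (edist_pt_le _ _ _ _ _).trans (ENNReal.ofReal_le_ofReal ?_)
    have h1 := hτ.dist_le_mul u v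
    rw [Real.dist_eq, Subtype.dist_eq, Real.dist_eq] at h1
    -- Since `τ ≥ -1`, horizontal motion is stretched by at most `p`; the vertical speed accounts
    -- for the `2` in the constant.
    have h2 : (p : ℝ) ^ (-τ v) ≤ p := by
      conv_rhs => rw [← Real.rpow_one (p : ℝ)]
      exact (Real.rpow_le_rpow_left_iff BallData.one_lt).2 (by linarith [hτ1 v])
    have h3 : |x + u * (y - x) - (x + v * (y - x))| ≤ |(u : ℝ) - v| := by
      rw [add_sub_add_left_eq_sub, ← sub_mul, abs_mul]
      exact mul_le_of_le_one_right (abs_nonneg _) hxy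
    have h4 := mul_le_mul h2 h3 (abs_nonneg _) BallData.pos.le
    push_cast at h1
    linarith
  have main : ∀ u v : I, u ≤ v → edist
      (pt (x + u * (y - x)) (if (u : ℝ) ≤ 1 / 2 then ξ else η) (τ u))
      (pt (x + v * (y - x)) (if (v : ℝ) ≤ 1 / 2 then ξ else η) (τ v)) ≤
        ENNReal.ofReal ((2 + p) * |(u : ℝ) - v|) := by
    intro u v huv
    have huv' : (u : ℝ) ≤ v := huv
    by_cases hv : (v : ℝ) ≤ 1 / 2
    · rw [if_pos hv, if_pos (huv'.trans hv)]
      exact key ξ u v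
    by_cases hu : (u : ℝ) ≤ 1 / 2
    · rw [if_pos hu, if_neg hv]
      let w : I := ⟨1 / 2, by norm_num, by norm_num⟩
      -- At height `0` the balls have radius `1`, so those around `ξ` and `η` coincide and the two
      -- halves of the curve meet.
      have e : pt (x + w * (y - x)) ξ (τ w) = pt (x + w * (y - x)) η (τ w) :=
        pt_eq_pt.2 ⟨rfl, rfl, by rw [hτ0 w rfl, Real.rpow_zero]; exact hξη⟩
      have h2 := key η w v
      rw [← e] at h2
      refine (edist_triangle _ _ _).trans ((add_le_add (key ξ u w) h2).trans (le_of_eq ?_))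
      rw [← ENNReal.ofReal_add (by positivity) (by positivity), ← mul_add]
      have hw : (w : ℝ) = 1 / 2 := rfl
      rw [hw, abs_of_nonpos (by linarith), abs_of_nonpos (by linarith [not_le.1 hv]),
        abs_of_nonpos (by linarith)]
      congr 2
      ring
    · rw [if_neg hu, if_neg hv]
      exact key η u v
  intro u v
  have e : ((2 + p : ℝ≥0) : ℝ≥0∞) * edist u v = ENNReal.ofReal ((2 + p) * |(u : ℝ) - v|) := by
    rw [edist_dist u v, Subtype.dist_eq, Real.dist_eq, ENNReal.ofReal_mul (by positivity)]
    congr 1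
    rw [ENNReal.ofReal_add (by positivity) (by positivity)]
    simp
  rw [e]
  rcases le_total u v with h | h
  · exact main u v h
  · rw [edist_comm, abs_sub_comm]
    exact main v u h

/-- The bound applies to every representative `ξ` of the tree point, since `of_edist_pt_lt` compares
arbitrary representatives. Properness evaluates it on the representatives that `affine_pt` produces.
-/
theorem exists_bound_of_edist_lt (z : MillefeuillePlane p) (L : ℝ) : ∃ C : ℝ, 0 ≤ C ∧
    ∀ x ξ t, edist z (pt x ξ t) < ENNReal.ofReal L → |x| ≤ C ∧ ‖ξ‖ ≤ C ∧ |t| ≤ C := by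
  obtain ⟨x₀, ξ₀, t₀, rfl⟩ := pt_surjective z
  have hl := HeintzePlane.log_pos (p := p)
  -- With `|L|` in the exponential the constant is nonnegative even for `L < 0`, where the distance
  -- hypothesis is vacuous.
  let C₁ := |x₀| + (p : ℝ) ^ (t₀ + L) * (Real.exp (Real.log p * |L|) - 1) / Real.log p
  let C₂ := ‖ξ₀‖ + (p : ℝ) ^ (t₀ + L + 1)
  let C₃ := |t₀| + |L|
  have hexp : 0 ≤ Real.exp (Real.log p * |L|) - 1 :=
    sub_nonneg.2 (Real.one_le_exp (by positivity))
  have hr : ∀ r : ℝ, 0 < (p : ℝ) ^ r := fun r => Real.rpow_pos_of_pos BallData.pos _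
  have hC₁ : 0 ≤ C₁ := by have := hr (t₀ + L); positivity
  have hC₂ : 0 ≤ C₂ := by have := hr (t₀ + L + 1); positivity
  have hC₃ : 0 ≤ C₃ := by positivity
  refine ⟨C₁ + C₂ + C₃, by positivity, fun x ξ t h => ?_⟩
  obtain ⟨h1, h2, h3⟩ := of_edist_pt_lt h
  refine ⟨?_, ?_, ?_⟩
  · have h4 : |x₀ - x| ≤ (p : ℝ) ^ (t₀ + L) * (Real.exp (Real.log p * |L|) - 1) / Real.log p := by
      rw [le_div_iff₀ hl, mul_comm]
      refine h3.trans ?_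
      have h5 : (p : ℝ) ^ t ≤ (p : ℝ) ^ (t₀ + L) :=
        (Real.rpow_le_rpow_left_iff BallData.one_lt).2 (by linarith [(abs_le.1 h1).1])
      have h6 : Real.exp (Real.log p * L) - 1 ≤ Real.exp (Real.log p * |L|) - 1 := by
        gcongr
        exact le_abs_self L
      exact (mul_le_mul_of_nonneg_left h6 (hr t).le).trans (mul_le_mul_of_nonneg_right h5 hexp)
    have h7 : |x| ≤ |x₀| + |x₀ - x| := by
      have := abs_sub_abs_le_abs_sub x x₀
      rw [abs_sub_comm] at this
      linarith
    linarith
  · have h7 : ‖ξ‖ ≤ ‖ξ₀‖ + ‖ξ₀ - ξ‖ := by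
      have := norm_sub_norm_le ξ ξ₀
      rw [norm_sub_rev] at this
      linarith
    linarith
  · have h7 : |t| ≤ |t₀| + |t₀ - t| := by
      have := abs_sub_abs_le_abs_sub t t₀
      rw [abs_sub_comm] at this
      linarith
    linarith [le_abs_self L]

end MillefeuillePlane

/-! ### `ℤ[1/p]` as a cocompact lattice in `ℝ × ℚ_p`. -/

namespace ZInv

variable {p : ℕ}

theorem exists_eq_mul_pInv_pow (z : ZInv p) : ∃ (n : ℤ) (k : ℕ), z * (p : ZInv p) ^ k = n := by
  obtain ⟨k, n, h⟩ := IsLocalization.Away.surj (p : ℤ) z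
  exact ⟨n, k, by simpa using h⟩

theorem mul_pow_mul_pInv_pow (z : ZInv p) (k : ℕ) : z * (p : ZInv p) ^ k * pInv p ^ k = z := by
  rw [mul_assoc, ← mul_pow, mul_pInv, one_pow, mul_one]

variable [hp : Fact p.Prime]

/-- The homomorphism from `ℤ[1/p]` to a field of characteristic zero. -/
noncomputable def toField (F : Type*) [Field F] [CharZero F] : ZInv p →+* F :=
  IsLocalization.Away.lift (p : ℤ) (g := Int.castRingHom F)
    (by simpa using hp.out.ne_zero)

theorem toField_pInv (F : Type*) [Field F] [CharZero F] : toField F (pInv p) = (p : F)⁻¹ := by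
  have h := congrArg (toField F) (mul_pInv p)
  rw [map_mul, map_natCast, map_one] at h
  exact eq_inv_of_mul_eq_one_right h

/-- This is `ℤ[1/p] ∩ ℤ_p = ℤ`: if `n / p ^ k` is a `p`-adic integer, then `p ^ k` divides `n`. -/
theorem exists_eq_intCast_of_norm_le_one {z : ZInv p} (hz : ‖toField ℚ_[p] z‖ ≤ 1) :
    ∃ m : ℤ, z = m := by
  obtain ⟨n, k, h⟩ := exists_eq_mul_pInv_pow z
  have h1 := congrArg (toField ℚ_[p]) h
  rw [map_mul, map_pow, map_natCast, map_intCast] at h1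
  have h2 : ‖(n : ℚ_[p])‖ ≤ (p : ℝ) ^ (-k : ℤ) := by
    rw [← h1, norm_mul, Padic.norm_p_pow]
    exact mul_le_of_le_one_left (zpow_pos BallData.pos _).le hz
  obtain ⟨m, rfl⟩ := (Padic.norm_int_le_pow_iff_dvd n k).1 h2
  refine ⟨m, ?_⟩
  rw [← mul_pow_mul_pInv_pow z k, h]
  push_cast
  rw [mul_comm _ (m : ZInv p), mul_pow_mul_pInv_pow]

/-- Discreteness of the lattice: the `p`-adic bound gives a common denominator `p ^ k`, and the real
bound leaves finitely many numerators. -/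
theorem finite_of_bounded (C : ℝ) :
    {z : ZInv p | |toField ℝ z| ≤ C ∧ ‖toField ℚ_[p] z‖ ≤ C}.Finite := by
  obtain ⟨k, hk⟩ := pow_unbounded_of_one_lt C (BallData.one_lt (p := p))
  refine ((Set.finite_Icc (-⌈C * (p : ℝ) ^ k⌉) ⌈C * (p : ℝ) ^ k⌉).image
    fun m : ℤ => (m : ZInv p) * pInv p ^ k).subset ?_
  rintro z ⟨h1, h2⟩
  obtain ⟨m, hm⟩ : ∃ m : ℤ, z * (p : ZInv p) ^ k = m := by
    refine exists_eq_intCast_of_norm_le_one ?_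
    have h0 : (0 : ℝ) < (p : ℝ) ^ k := pow_pos BallData.pos _
    rw [map_mul, map_pow, map_natCast, norm_mul, Padic.norm_p_pow, zpow_neg, zpow_natCast,
      ← div_eq_mul_inv, div_le_one h0]
    exact h2.trans hk.le
  refine ⟨m, ?_, by simp only [← hm, mul_pow_mul_pInv_pow]⟩
  have h3 : |(m : ℝ)| ≤ C * (p : ℝ) ^ k := by
    have := congrArg (toField ℝ) hm
    rw [map_mul, map_pow, map_natCast, map_intCast] at this
    rw [← this, abs_mul, abs_of_pos (pow_pos (BallData.pos (p := p)) k)]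
    exact mul_le_mul_of_nonneg_right h1 (pow_pos BallData.pos _).le
  have h4 := (abs_le.1 h3)
  have h5 := Int.le_ceil (C * (p : ℝ) ^ k)
  constructor
  · have : -(⌈C * (p : ℝ) ^ k⌉ : ℝ) ≤ m := by linarith
    exact_mod_cast this
  · have : (m : ℝ) ≤ ⌈C * (p : ℝ) ^ k⌉ := by linarith
    exact_mod_cast this

/-- The translates of `[0, 1) × ℤ_p` by `ℤ[1/p]` cover `ℝ × ℚ_p`. -/
theorem exists_sub_mem (x : ℝ) (ξ : ℚ_[p]) : ∃ z : ZInv p,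
    0 ≤ x - toField ℝ z ∧ x - toField ℝ z ≤ 1 ∧ ‖ξ - toField ℚ_[p] z‖ ≤ 1 := by
  obtain ⟨k, hk⟩ := pow_unbounded_of_one_lt ‖ξ‖ (BallData.one_lt (p := p))
  have h0 : (0 : ℝ) < (p : ℝ) ^ k := pow_pos BallData.pos _
  have hp0 : (p : ℚ_[p]) ≠ 0 := by exact_mod_cast hp.out.ne_zero
  have h1 : ‖ξ * (p : ℚ_[p]) ^ k‖ ≤ 1 := by
    rw [norm_mul, Padic.norm_p_pow, zpow_neg, zpow_natCast, ← div_eq_mul_inv, div_le_one h0]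
    exact hk.le
  let ζ : ℤ_[p] := ⟨ξ * (p : ℚ_[p]) ^ k, h1⟩
  -- An integer congruent to `p ^ k * ξ` modulo `p ^ k`; thus `n / p ^ k` agrees with `ξ` modulo
  -- `ℤ_p`.
  let n : ℕ := ζ.appr k
  have h2 : ‖ξ * (p : ℚ_[p]) ^ k - n‖ ≤ (p : ℝ) ^ (-k : ℤ) := by
    have := (PadicInt.norm_le_pow_iff_mem_span_pow _ _).2 (PadicInt.appr_spec k ζ)
    rw [PadicInt.norm_def, PadicInt.coe_sub, PadicInt.coe_natCast] at this
    exact this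
  let w : ZInv p := n * pInv p ^ k
  -- Adding an integer corrects the real place and costs nothing at the `p`-adic place.
  refine ⟨w + (⌊x - toField ℝ w⌋ : ℤ), ?_, ?_, ?_⟩
  · rw [map_add, map_intCast]
    linarith [Int.floor_le (x - toField ℝ w)]
  · rw [map_add, map_intCast]
    linarith [Int.lt_floor_add_one (x - toField ℝ w)]
  · rw [map_add, map_intCast, ← sub_sub]
    refine (PadicTree.norm_sub_le_max _ _).trans (max_le ?_ (Padic.norm_int_le_one _))
    have e : ξ - toField ℚ_[p] w = (ξ * (p : ℚ_[p]) ^ k - n) * ((p : ℚ_[p]) ^ k)⁻¹ := by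
      simp only [w]
      rw [map_mul, map_natCast, map_pow, toField_pInv, inv_pow, sub_mul,
        mul_inv_cancel_right₀ (pow_ne_zero _ hp0)]
    rw [e, norm_mul, norm_inv, Padic.norm_p_pow, ← div_eq_mul_inv, div_le_one (zpow_pos BallData.pos _)]
    exact h2

end ZInv

/-! ### Eigencoordinates of `A` over `ℝ` and `ℚ_p`. -/

section Coordinates

variable {p : ℕ} {A P : GL (Fin 2) (ZInv p)}

theorem mulVec_matrixAut (hP : P * A * P⁻¹ = diagMatrix p)
    (v : Multiplicative (Fin 2 → ZInv p)) :
    (P : Matrix (Fin 2) (Fin 2) (ZInv p)).mulVec (matrixAut A v).toAdd =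
      (diagMatrix p : Matrix (Fin 2) (Fin 2) (ZInv p)).mulVec
        ((P : Matrix (Fin 2) (Fin 2) (ZInv p)).mulVec v.toAdd) := by
  rw [Matrix.mulVec_mulVec, ← Units.val_mul, ← hP, inv_mul_cancel_right, Units.val_mul,
    ← Matrix.mulVec_mulVec]
  rfl

theorem Gp.injective_coordinates (P : GL (Fin 2) (ZInv p)) : Function.Injective fun g : Gp p A =>
    ((P : Matrix (Fin 2) (Fin 2) (ZInv p)).mulVec g.left.toAdd, g.right.toAdd) := by
  intro g h hgh
  obtain ⟨h1, h2⟩ := Prod.ext_iff.1 hgh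
  refine SemidirectProduct.ext ?_ h2
  have h3 := congrArg ((P⁻¹ : GL (Fin 2) (ZInv p)) : Matrix (Fin 2) (Fin 2) (ZInv p)).mulVec h1
  simp only [Matrix.mulVec_mulVec, ← Units.val_mul, inv_mul_cancel, Units.val_one,
    Matrix.one_mulVec] at h3
  exact h3

variable [hp : Fact p.Prime]

/-- The `i`-th coordinate, in a field `F`, of the vector `P v` of `ℤ[1/p]²`. -/
noncomputable def coord (P : GL (Fin 2) (ZInv p)) (F : Type*) [Field F] [CharZero F] (i : Fin 2)
    (v : Multiplicative (Fin 2 → ZInv p)) : F :=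
  ZInv.toField F ((P : Matrix (Fin 2) (Fin 2) (ZInv p)).mulVec v.toAdd i)

theorem zpow_apply_of_apply_eq_mul {M F : Type*} [Group M] [Field F] {e : MulAut M} {c : M → F} {u : F}
    (hu : u ≠ 0) (h : ∀ v, c (e v) = u * c v) (k : ℤ) (v : M) : c ((e ^ k) v) = u ^ k * c v := by
  induction k generalizing v with
  | zero => simp
  | succ k ih => rw [zpow_add_one, MulAut.mul_apply, ih, h, zpow_add_one₀ hu, mul_assoc]
  | pred k ih =>
    have h1 := h (e⁻¹ v)
    rw [MulAut.apply_inv_self] at h1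
    rw [zpow_sub_one, MulAut.mul_apply, ih, zpow_sub_one₀ hu, h1, mul_assoc, inv_mul_cancel_left₀ hu]

variable {F : Type*} [Field F] [CharZero F]

theorem coord_one (P : GL (Fin 2) (ZInv p)) (i : Fin 2) : coord P F i 1 = 0 := by
  simp [coord]

theorem coord_mul (P : GL (Fin 2) (ZInv p)) (i : Fin 2) (v w : Multiplicative (Fin 2 → ZInv p)) :
    coord P F i (v * w) = coord P F i v + coord P F i w := by
  simp [coord, Matrix.mulVec_add]

theorem coord_zero_zpow (hP : P * A * P⁻¹ = diagMatrix p) (k : ℤ)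
    (v : Multiplicative (Fin 2 → ZInv p)) :
    coord P F 0 ((matrixAut A ^ k) v) = (p : F) ^ k * coord P F 0 v := by
  have hp0 : (p : F) ≠ 0 := by exact_mod_cast hp.out.ne_zero
  refine zpow_apply_of_apply_eq_mul hp0 (fun v => ?_) k v
  rw [coord, mulVec_matrixAut hP]
  simp [diagMatrix, coord, Matrix.mulVec, dotProduct, Fin.sum_univ_two]

theorem coord_one_zpow (hP : P * A * P⁻¹ = diagMatrix p) (k : ℤ)
    (v : Multiplicative (Fin 2 → ZInv p)) :
    coord P F 1 ((matrixAut A ^ k) v) = (p : F) ^ (-k) * coord P F 1 v := by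
  have hp0 : (p : F) ≠ 0 := by exact_mod_cast hp.out.ne_zero
  rw [zpow_neg, ← inv_zpow]
  refine zpow_apply_of_apply_eq_mul (inv_ne_zero hp0) (fun v => ?_) k v
  rw [coord, mulVec_matrixAut hP]
  simp [diagMatrix, coord, Matrix.mulVec, dotProduct, Fin.sum_univ_two, ZInv.toField_pInv]

end Coordinates

/-! ### The action of `G_p` and its geometry. -/

namespace Gp

open MillefeuillePlane

variable {p : ℕ} [hp : Fact p.Prime] {A P : GL (Fin 2) (ZInv p)}

/-- The isometry by which an element of `G_p` acts on the first factor. -/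
noncomputable def fstIso (P : GL (Fin 2) (ZInv p)) (g : Gp p A) :
    MillefeuillePlane p ≃ᵢ MillefeuillePlane p :=
  -- The real place of one eigencoordinate goes with the `p`-adic place of the other: under `A ^ k`
  -- both absolute values scale by `p ^ k`.
  affineIso (coord P ℝ 0 g.left) (coord P ℚ_[p] 1 g.left) g.right.toAdd

/-- The isometry by which an element of `G_p` acts on the second factor. -/
noncomputable def sndIso (P : GL (Fin 2) (ZInv p)) (g : Gp p A) :
    MillefeuillePlane p ≃ᵢ MillefeuillePlane p :=
  -- Here both absolute values scale by `p ^ (-k)` under `A ^ k`, hence the opposite height change.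
  affineIso (coord P ℝ 1 g.left) (coord P ℚ_[p] 0 g.left) (-g.right.toAdd)

theorem fstIso_mul (hP : P * A * P⁻¹ = diagMatrix p) (g h : Gp p A) (z : MillefeuillePlane p) :
    fstIso P (g * h) z = fstIso P g (fstIso P h z) := by
  simp only [fstIso, affineIso_apply, affine_affine, SemidirectProduct.mul_left,
    SemidirectProduct.mul_right, coord_mul, zpowersHom_apply, coord_zero_zpow hP,
    coord_one_zpow hP, toAdd_mul]

theorem sndIso_mul (hP : P * A * P⁻¹ = diagMatrix p) (g h : Gp p A) (z : MillefeuillePlane p) :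
    sndIso P (g * h) z = sndIso P g (sndIso P h z) := by
  simp only [sndIso, affineIso_apply, affine_affine, SemidirectProduct.mul_left,
    SemidirectProduct.mul_right, coord_mul, zpowersHom_apply, coord_zero_zpow hP,
    coord_one_zpow hP, toAdd_mul, neg_neg, neg_add]

theorem busemann_fstIso_eq (P : GL (Fin 2) (ZInv p)) (g : Gp p A) {x y : MillefeuillePlane p}
    (h : x.busemann = -y.busemann) : (fstIso P g x).busemann = -(sndIso P g y).busemann := by
  simp only [fstIso, sndIso, affineIso_apply, busemann_affine_apply, h]
  push_cast
  ring

/-- The action of `G_p` on `ℍ²_p[p] ⋈ ℍ²_p[p]`. -/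
@[reducible]
noncomputable def action (hP : P * A * P⁻¹ = diagMatrix p) :
    MulAction (Gp p A) (HorocyclicPlanes p) where
  smul g z := ⟨fstIso P g z.fst, sndIso P g z.snd, busemann_fstIso_eq P g z.busemann_eq⟩
  one_smul z := Horocyclic.ext
    (by
      change fstIso P 1 z.fst = z.fst
      simp [fstIso, affineIso_apply, coord_one, affine_zero])
    (by
      change sndIso P 1 z.snd = z.snd
      simp [sndIso, affineIso_apply, coord_one, affine_zero])
  mul_smul g h z := Horocyclic.ext (fstIso_mul hP g h z.fst) (sndIso_mul hP g h z.snd)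

theorem actsByProductMaps (hP : P * A * P⁻¹ = diagMatrix p) :
    letI := action hP
    ActsByProductMaps (Gp p A) (Millefeuille.busemann : MillefeuillePlane p → ℝ)
      (Millefeuille.busemann : MillefeuillePlane p → ℝ) :=
  fun g => ⟨fstIso P g, sndIso P g, ⟨fixesInfinity_affineIso _ _ _, fixesInfinity_affineIso _ _ _,
    (g.right.toAdd : ℤ), hasHeightChange_affineIso _ _ _,
    Int.cast_neg (R := ℝ) _ ▸ hasHeightChange_affineIso _ _ _⟩, fun _ => ⟨rfl, rfl⟩⟩

variable {N : Seminorm ℝ (ℝ × ℝ)}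

theorem horoEDist_smul (hP : P * A * P⁻¹ = diagMatrix p) (g : Gp p A) (a b : HorocyclicPlanes p) :
    letI := action hP
    horoEDist N (g • a) (g • b) = horoEDist N a b := by
  let := action hP
  have key : ∀ (g : Gp p A) (a b : HorocyclicPlanes p),
      horoEDist N (g • a) (g • b) ≤ horoEDist N a b := fun g a b =>
    Horocyclic.horoEDist_map_le (fstIso P g).isometry (sndIso P g).isometry
      (fun _ _ h => busemann_fstIso_eq P g h) rfl rfl rfl rfl
  refine le_antisymm (key g a b) ?_
  simpa using key g⁻¹ (g • a) (g • b)

theorem finite_of_bounded (P : GL (Fin 2) (ZInv p)) (C : ℝ) :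
    {g : Gp p A | (∀ i, |coord P ℝ i g.left| ≤ C ∧ ‖coord P ℚ_[p] i g.left‖ ≤ C) ∧
      |(g.right.toAdd : ℝ)| ≤ C}.Finite := by
  have h1 := Set.Finite.pi' (ι := Fin 2) fun _ => ZInv.finite_of_bounded (p := p) C
  have h2 := h1.prod (Set.finite_Icc (-⌈C⌉) ⌈C⌉)
  refine (h2.preimage (injective_coordinates (A := A) P).injOn).subset ?_
  rintro g ⟨hg1, hg2⟩
  refine ⟨hg1, ?_⟩
  have h5 := (Int.le_ceil C)
  have h4 := abs_le.1 hg2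
  constructor
  · have : -(⌈C⌉ : ℝ) ≤ g.right.toAdd := by linarith
    exact_mod_cast this
  · have : (g.right.toAdd : ℝ) ≤ ⌈C⌉ := by linarith
    exact_mod_cast this

/-- Solve for the translation part; at both places the linear part has absolute value `p ^ n ≤ p ^
(2 * C)`. -/
theorem abs_le_of_affine {a x C : ℝ} {α ξ : ℚ_[p]} {n : ℤ} (hn : |(n : ℝ)| ≤ 2 * C)
    (hx : |x| ≤ C) (hξ : ‖ξ‖ ≤ C) (hx' : |a + (p : ℝ) ^ n * x| ≤ C)
    (hξ' : ‖α + (p : ℚ_[p]) ^ (-n) * ξ‖ ≤ C) :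
    |a| ≤ C + (p : ℝ) ^ (2 * C) * C ∧ ‖α‖ ≤ C + (p : ℝ) ^ (2 * C) * C := by
  have hC : 0 ≤ C := (abs_nonneg x).trans hx
  have h0 : 0 < (p : ℝ) ^ n := zpow_pos BallData.pos _
  have h1 : (p : ℝ) ^ n ≤ (p : ℝ) ^ (2 * C) := by
    rw [← Real.rpow_intCast]
    exact (Real.rpow_le_rpow_left_iff BallData.one_lt).2 ((le_abs_self _).trans hn)
  constructor
  · have h2 := abs_sub (a + (p : ℝ) ^ n * x) ((p : ℝ) ^ n * x)
    rw [add_sub_cancel_right, abs_mul, abs_of_pos h0] at h2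
    have h3 := mul_le_mul h1 hx (abs_nonneg x) (h0.le.trans h1)
    linarith
  · have h2 := norm_sub_le (α + (p : ℚ_[p]) ^ (-n) * ξ) ((p : ℚ_[p]) ^ (-n) * ξ)
    rw [add_sub_cancel_right, norm_mul, Padic.norm_p_zpow, neg_neg] at h2
    have h3 := mul_le_mul h1 hξ (norm_nonneg ξ) (h0.le.trans h1)
    linarith

theorem proper (hP : P * A * P⁻¹ = diagMatrix p) (hN : IsAdmissibleMonotone N)
    (B : Set (HorocyclicPlanes p)) (hB : BoundedFor (horoEDist N) B) :
    letI := action hP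
    {g : Gp p A | ∃ x ∈ B, g • x ∈ B}.Finite := by
  obtain ⟨R, hR⟩ := hB
  rcases B.eq_empty_or_nonempty with rfl | ⟨z₀, hz₀⟩
  · simp
  -- Enlarging `R` by `1` gives the strict inequality needed to pick a path below the infimum.
  have hlt : ∀ z ∈ B, horoEDist N z₀ z < ENNReal.ofReal (R + 1) := fun z hz => by
    refine (hR z₀ hz₀ z hz).trans_lt ?_
    rw [← ENNReal.ofReal_coe_nnreal, ENNReal.ofReal_lt_ofReal_iff (by positivity)]
    exact lt_add_one _
  obtain ⟨C₁, hC₁, h1⟩ := exists_bound_of_edist_lt z₀.fst (2 * (R + 1))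
  obtain ⟨C₂, hC₂, h2⟩ := exists_bound_of_edist_lt z₀.snd (2 * (R + 1))
  set C := max C₁ C₂
  have hC : 0 ≤ C := hC₁.trans (le_max_left _ _)
  have h1' : ∀ z ∈ B, ∀ x ξ t, z.fst = pt x ξ t → |x| ≤ C ∧ ‖ξ‖ ≤ C ∧ |t| ≤ C := by
    intro z hz x ξ t e
    have := h1 x ξ t (e ▸ (Horocyclic.edist_le_of_horoEDist_lt hN (hlt z hz)).1)
    exact ⟨this.1.trans (le_max_left _ _), this.2.1.trans (le_max_left _ _),
      this.2.2.trans (le_max_left _ _)⟩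
  have h2' : ∀ z ∈ B, ∀ x ξ t, z.snd = pt x ξ t → |x| ≤ C ∧ ‖ξ‖ ≤ C ∧ |t| ≤ C := by
    intro z hz x ξ t e
    have := h2 x ξ t (e ▸ (Horocyclic.edist_le_of_horoEDist_lt hN (hlt z hz)).2)
    exact ⟨this.1.trans (le_max_right _ _), this.2.1.trans (le_max_right _ _),
      this.2.2.trans (le_max_right _ _)⟩
  refine (finite_of_bounded P (C + (p : ℝ) ^ (2 * C) * C + 2 * C)).subset ?_
  rintro g ⟨z, hz, hgz⟩
  obtain ⟨x, ξ, t, hX⟩ := pt_surjective z.fst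
  obtain ⟨y, η, s, hY⟩ := pt_surjective z.snd
  have hX' : fstIso P g z.fst = _ := hX ▸ affine_pt _ _ _ _ _ _
  have hY' : sndIso P g z.snd = _ := hY ▸ affine_pt _ _ _ _ _ _
  obtain ⟨a1, a2, a3⟩ := h1' z hz _ _ _ hX
  obtain ⟨b1, b2, b3⟩ := h2' z hz _ _ _ hY
  obtain ⟨c1, c2, c3⟩ := h1' _ hgz _ _ _ hX'
  obtain ⟨d1, d2, d3⟩ := h2' _ hgz _ _ _ hY'
  have hk : |(g.right.toAdd : ℝ)| ≤ 2 * C := by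
    have := abs_sub (g.right.toAdd + t : ℝ) t
    rw [add_sub_cancel_right] at this
    linarith
  have hk' : |((-g.right.toAdd : ℤ) : ℝ)| ≤ 2 * C := by
    rw [Int.cast_neg, abs_neg]
    exact hk
  obtain ⟨e1, e2⟩ := abs_le_of_affine hk a1 a2 c1 c2
  obtain ⟨f1, f2⟩ := abs_le_of_affine hk' b1 b2 d1 d2
  have h0 : 0 ≤ (p : ℝ) ^ (2 * C) * C :=
    mul_nonneg (Real.rpow_pos_of_pos BallData.pos _).le hC
  refine ⟨fun i => ?_, by linarith⟩
  -- Each eigencoordinate is bounded at its two places by different factors: one estimate comes from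
  -- `X`, the other from `Y`.
  fin_cases i
  · exact ⟨e1.trans (by linarith), f2.trans (by linarith)⟩
  · exact ⟨f1.trans (by linarith), e2.trans (by linarith)⟩

/-- A bounded set whose translates cover `ℍ²_p[p] ⋈ ℍ²_p[p]`. -/
def fundamentalSet (p : ℕ) [Fact p.Prime] : Set (HorocyclicPlanes p) :=
  {z | ∃ x ξ y η t, 0 ≤ x ∧ x ≤ 1 ∧ ‖ξ‖ ≤ 1 ∧ 0 ≤ y ∧ y ≤ 1 ∧ ‖η‖ ≤ 1 ∧ 0 ≤ t ∧ t ≤ 1 ∧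
    z.fst = pt x ξ t ∧ z.snd = pt y η (-t)}

theorem boundedFor_fundamentalSet (hN : IsAdmissibleMonotone N) :
    BoundedFor (horoEDist N) (fundamentalSet p) := by
  refine ⟨2 + p, ?_⟩
  rintro z ⟨x, ξ, y, η, t, hx0, hx1, hξ, hy0, hy1, hη, ht0, ht1, hX, hY⟩
    z' ⟨x', ξ', y', η', t', hx0', hx1', hξ', hy0', hy1', hη', ht0', ht1', hX', hY'⟩
  -- A V-shaped height profile from `t` through `0` at `u = 1 / 2` to `t'`. The second factor
  -- follows `-τ`, so both factors can change sheets at height `0`.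
  let τ : I → ℝ := fun u => max (t * (1 - 2 * u)) (t' * (2 * u - 1))
  have hlin : ∀ c : ℝ, |c| ≤ 2 → ∀ d : ℝ, LipschitzWith 2 fun u : I => c * u + d := by
    intro c hc d
    refine LipschitzWith.of_dist_le_mul fun u v => ?_
    rw [Real.dist_eq, Subtype.dist_eq, Real.dist_eq, add_sub_add_right_eq_sub, ← mul_sub, abs_mul]
    exact mul_le_mul_of_nonneg_right hc (abs_nonneg _)
  have hτ : LipschitzWith 2 τ := by
    have h1 := hlin (-2 * t) (by rw [abs_le]; constructor <;> linarith) t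
    have h2 := hlin (2 * t') (by rw [abs_le]; constructor <;> linarith) (-t')
    have := h1.max h2
    rw [max_self] at this
    convert this using 3
    · ring
    · ring
  have hτ' : LipschitzWith 2 fun u => -τ u := hτ.neg
  have hτ0 : ∀ u, 0 ≤ τ u := fun u => by
    rcases le_total (u : ℝ) (1 / 2) with h | h
    · exact le_max_of_le_left (mul_nonneg ht0 (by linarith))
    · exact le_max_of_le_right (mul_nonneg ht0' (by linarith))
  have hτ1 : ∀ u, τ u ≤ 1 := fun u => by
    have h0 := u.2.1
    have h1 := u.2.2
    refine max_le ?_ ?_ <;> nlinarith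
  have hτh : ∀ u : I, (u : ℝ) = 1 / 2 → τ u = 0 := fun u hu => by simp [τ, hu]
  have hdist : ∀ {a b : ℚ_[p]}, ‖a‖ ≤ 1 → ‖b‖ ≤ 1 → ‖a - b‖ ≤ 1 := fun ha hb =>
    (PadicTree.norm_sub_le_max _ _).trans (max_le ha hb)
  have hγ := lipschitzWith_pt (x := x) (y := x') (by rw [abs_le]; constructor <;> linarith)
    (hdist hξ hξ') hτ (fun u => by linarith [hτ0 u]) hτh
  have hδ := lipschitzWith_pt (x := y) (y := y') (by rw [abs_le]; constructor <;> linarith)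
    (hdist hη hη') hτ' (fun u => by linarith [hτ1 u]) (fun u hu => by rw [hτh u hu, neg_zero])
  have e0 : τ 0 = t := by simp only [τ]; norm_num; linarith
  have e1 : τ 1 = t' := by simp only [τ]; norm_num; linarith
  have hhalf : ¬(1 : ℝ) ≤ 2⁻¹ := by norm_num
  let γ : Path z.fst z'.fst :=
    { toFun := _
      continuous_toFun := hγ.continuous
      source' := by simp [hX, e0]
      target' := by simp [hX', e1, hhalf] }
  let δ : Path z.snd z'.snd :=
    { toFun := _
      continuous_toFun := hδ.continuous
      source' := by simp [hY, e0]
      target' := by simp [hY', e1, hhalf] }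
  refine (iInf₂_le γ δ).trans ((iInf_le _ fun u => ?_).trans
    (Horocyclic.pathLength_le_of_lipschitz hN hγ hδ))
  change -τ u = -(- -τ u)
  rw [neg_neg]

/-- The field is quantified after `w`, since the same group element has to serve the real and the
`p`-adic places. -/
theorem exists_coord_eq (P : GL (Fin 2) (ZInv p)) (v : Fin 2 → ZInv p) :
    ∃ w : Multiplicative (Fin 2 → ZInv p), ∀ (F : Type) [Field F] [CharZero F] (i : Fin 2),
      coord P F i w = ZInv.toField F (v i) := by
  refine ⟨Multiplicative.ofAdd
    (((P⁻¹ : GL (Fin 2) (ZInv p)) : Matrix (Fin 2) (Fin 2) (ZInv p)).mulVec v), ?_⟩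
  intro F _ _ i
  rw [coord, toAdd_ofAdd, Matrix.mulVec_mulVec, ← Units.val_mul, mul_inv_cancel, Units.val_one,
    Matrix.one_mulVec]

theorem exists_smul_mem_fundamentalSet (hP : P * A * P⁻¹ = diagMatrix p)
    (z : HorocyclicPlanes p) :
    letI := action hP
    ∃ g : Gp p A, g • z ∈ fundamentalSet p := by
  obtain ⟨x, ξ, t, hX⟩ := pt_surjective z.fst
  obtain ⟨y, η, s, hY⟩ := pt_surjective z.snd
  obtain rfl : s = -t := by
    have := z.busemann_eq
    rw [hX, hY, busemann_pt, busemann_pt] at this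
    linarith
  -- This brings the first height to the fractional part of `t`.
  let k : ℤ := -⌊t⌋
  -- The real coordinate of the first factor and the `p`-adic one of the second are reduced
  -- together, because the same eigencoordinate translates both. The form `- -k` is what `affine_pt`
  -- produces for the exponent `-k` of the second factor.
  obtain ⟨v₀, a1, a2, a3⟩ := ZInv.exists_sub_mem ((p : ℝ) ^ k * x) ((p : ℚ_[p]) ^ (- -k) * η)
  obtain ⟨v₁, b1, b2, b3⟩ := ZInv.exists_sub_mem ((p : ℝ) ^ (-k) * y) ((p : ℚ_[p]) ^ (-k) * ξ)
  obtain ⟨w, hw⟩ := exists_coord_eq P ![-v₀, -v₁]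
  have hX' : fstIso P (⟨w, Multiplicative.ofAdd k⟩ : Gp p A) z.fst = _ := hX ▸ affine_pt _ _ _ _ _ _
  have hY' : sndIso P (⟨w, Multiplicative.ofAdd k⟩ : Gp p A) z.snd = _ := hY ▸ affine_pt _ _ _ _ _ _
  simp only [hw, toAdd_ofAdd, Matrix.cons_val_zero, Matrix.cons_val_one, map_neg,
    neg_add_eq_sub] at hX' hY'
  refine ⟨⟨w, Multiplicative.ofAdd k⟩, _, _, _, _, _, a1, a2, b3, b1, b2, a3, ?_, ?_, hX',
    hY'.trans (congrArg _ ?_)⟩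
  · simp only [k, Int.cast_neg]
    linarith [Int.floor_le t]
  · simp only [k, Int.cast_neg]
    linarith [Int.lt_floor_add_one t]
  · push_cast
    ring

theorem isGeometric (hP : P * A * P⁻¹ = diagMatrix p) (hN : IsAdmissibleMonotone N) :
    letI := action hP
    IsGeometric (Gp p A) (horoEDist N : HorocyclicPlanes p → HorocyclicPlanes p → ℝ≥0∞) := by
  let := action hP
  refine ⟨horoEDist_smul hP, proper hP hN, fundamentalSet p, boundedFor_fundamentalSet hN,
    fun z => ?_⟩
  obtain ⟨g, hg⟩ := exists_smul_mem_fundamentalSet hP z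
  exact ⟨g⁻¹, g • z, hg, (inv_smul_smul g z).symm⟩

end Gp

end HorocyclicSol

theorem mainTheorem4 (p : ℕ) [Fact p.Prime] (A : GL (Fin 2) (HorocyclicSol.ZInv p))
    (hA : IsConj A (HorocyclicSol.diagMatrix p)) :
    ∃ _ : MulAction (HorocyclicSol.Gp p A) (HorocyclicSol.HorocyclicPlanes p),
      HorocyclicSol.ActsByProductMaps (HorocyclicSol.Gp p A)
        (HorocyclicSol.Millefeuille.busemann : HorocyclicSol.MillefeuillePlane p → ℝ)
        (HorocyclicSol.Millefeuille.busemann : HorocyclicSol.MillefeuillePlane p → ℝ) ∧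
      ∀ N : Seminorm ℝ (ℝ × ℝ), HorocyclicSol.IsAdmissibleMonotone N →
        HorocyclicSol.IsGeometric (HorocyclicSol.Gp p A)
          (HorocyclicSol.horoEDist N :
            HorocyclicSol.HorocyclicPlanes p → HorocyclicSol.HorocyclicPlanes p → ENNReal) := by
  obtain ⟨P, hP⟩ := isConj_iff.1 hA
  exact ⟨HorocyclicSol.Gp.action hP, HorocyclicSol.Gp.actsByProductMaps hP,
    fun _ hN => HorocyclicSol.Gp.isGeometric hP hN⟩
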